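/- Let $P$ be a finite set, and for a permutation $\pi$ let $z(\pi)$ be its number of cycles, fixed points included. A pair $(\sigma,\alpha)$ of permutations of $P$ is a \emph{hypermap} if the group $\langle\sigma,\alpha\rangle$ has exactly one orbit on $P$ (so $P\neq\emptyset$); its \emph{genus} $g(\sigma,\alpha)$ is given by $|P|+2-2g(\sigma,\alpha)=z(\sigma)+z(\alpha)+z(\alpha^{-1}\sigma)$. A permutation $\theta$ of $P$ is a \emph{refinement} of $\alpha$ if every cycle of $\alpha$, viewed as a set $C$ of points, is mapped to itself by $\theta$ and the restrictions to $C$ satisfy $g(\theta|_C,\alpha|_C)=0$. A \emph{spanning hypertree} of $(\sigma,\alpha)$ is a pair $(\sigma,\theta)$ where $\theta$ is a refinement of $\alpha$ such that $(\sigma,\theta)$ is a hypermap with $z(\theta^{-1}\sigma)=1$ and $g(\sigma,\theta)=0$. Let $(\sigma,\alpha)$ be a hypermap such that every cycle of $\alpha$ has at most three points. Its \emph{associated two-colored graph} $G=G(\sigma,\alpha)$ is the following graph, in which loops and parallel edges are allowed. For each point $i$ lying on a $3$-cycle of $\alpha$ take a new (white) point $i'$; the points of $P$ are black. Let $\widetilde\sigma$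 be the permutation of all black and white points that has all cycles of $\sigma$ and, for each $3$-cycle $(i,j,k)$ of $\alpha$, the cycle $(i',k',j')$. Let $\widetilde\alpha$ be the permutation of all these points that has all $2$-cycles of $\alpha$, the $2$-cycle $(i,i')$ for each point $i$ lying on a $3$-cycle of $\alpha$, and no other non-trivial cycles. The vertices of $G$ are the cycles of $\widetilde\sigma$, and each $2$-cycle $(p,q)$ of $\widetilde\alpha$ is an edge of $G$ joining the cycle of $\widetilde\sigma$ containing $p$ to the cycle of $\widetilde\sigma$ containing $q$. Let $V$ be the set of all vertices of $G$, and $W\subseteq V$ the set of white vertices, that is, of the cycles of $\widetilde\sigma$ consisting of white points. For $X\subseteq V$ let $G|_X$ be the graph with vertex set $X$ whose edges are the edges of $G$ with both endpoints in $X$, and let $s(H)$ be the number of spanning trees of a graph $H$ (parallel edges being distinguished). Then the number of spanning hypertrees of $(\sigma,\alpha)$ equals $$\sum_{S\subseteq W}(-2)^{|S|}\,s\left(G|_{V\setminus S}\right).$$ -/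

import Mathlib

namespace Hypermap

open Equiv

noncomputable section

/-- The set of cycles of a permutation, fixed points being cycles of length one. -/
abbrev Cycles {P : Type*} (π : Perm P) : Type _ := Quotient (Perm.SameCycle.setoid π)

/-- The cycle of `π` that contains the point `p`. -/
abbrev cycleAt {P : Type*} (π : Perm P) (p : P) : Cycles π :=
  Quotient.mk (Perm.SameCycle.setoid π) p

/-- `z π`: the number of cycles of `π`, fixed points included. -/
def z {P : Type*} (π : Perm P) : ℕ := Nat.card (Cycles π)

/-- `κ σ α`: the number of orbits of the group generated by `σ` and `α`. -/
def κ {P : Type*} (σ α : Perm P) : ℕ :=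
  Nat.card (MulAction.orbitRel.Quotient (Subgroup.closure {σ, α} : Subgroup (Perm P)) P)

/-- The pair `(σ, α)` is a hypermap: it has exactly one connected component. -/
def IsHypermap {P : Type*} (σ α : Perm P) : Prop := κ σ α = 1

/-- The genus `g` of a hypermap `(σ, α)` on `n` points, determined by
`n + 2 - 2 g = z(σ) + z(α) + z(α⁻¹ σ)`. It is only used for pairs generating a transitive
group. -/
def genus {P : Type*} (σ α : Perm P) : ℚ :=
  ((Nat.card P : ℚ) + 2 - z σ - z α - z (α⁻¹ * σ)) / 2

/-- `θ` is a refinement of `γ`: every cycle of `γ` is, as a set of points, invariant under `θ`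
(so that it is a union of cycles of `θ`), and the permutations `θᵢ`, `γᵢ` induced by `θ` and `γ`
on such a set satisfy `g(θᵢ, γᵢ) = 0`. -/
def IsRefinement {P : Type*} (θ γ : Perm P) : Prop :=
  ∃ h : ∀ x y : P, γ.SameCycle x (θ y) ↔ γ.SameCycle x y,
    ∀ x : P, genus
      (θ.subtypePerm (p := fun y => γ.SameCycle x y) (h x))
      (γ.subtypePerm (p := fun y => γ.SameCycle x y) (fun _ => Perm.sameCycle_apply_right)) = 0

/-- `(σ, θ)` is a spanning hypertree of `(σ, α)`: `θ` refines `α`, the pair `(σ, θ)` is a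
hypermap, it has exactly one face, and its genus is zero. -/
def IsSpanningHypertree {P : Type*} (σ α θ : Perm P) : Prop :=
  IsRefinement θ α ∧ IsHypermap σ θ ∧ z (θ⁻¹ * σ) = 1 ∧ genus σ θ = 0

/-- The number of spanning hypertrees of `(σ, α)`. -/
def numSpanningHypertrees {P : Type*} (σ α : Perm P) : ℕ :=
  Nat.card {θ : Perm P // IsSpanningHypertree σ α θ}

/-- All cycles of `α` have at most three points (the length of the cycle of `α` through `p` is
the minimal period of `p`). -/
def HasShortHyperedges {P : Type*} (α : Perm P) : Prop :=
  ∀ p : P, Function.minimalPeriod α p ≤ 3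

/-- The white points: one copy `i'` of each point `i` lying on a `3`-cycle of `α`. -/
abbrev White {P : Type*} (α : Perm P) : Type _ := {i : P // Function.minimalPeriod α i = 3}

theorem minimalPeriod_apply_eq {P : Type*} [Finite P] (α : Perm P) (i : P) :
    Function.minimalPeriod α (α i) = Function.minimalPeriod α i :=
  Function.minimalPeriod_apply (α.injective.mem_periodicPts i)

theorem minimalPeriod_symm_apply_eq {P : Type*} [Finite P] (α : Perm P) (i : P) :
    Function.minimalPeriod α (α.symm i) = Function.minimalPeriod α i := by
  rw [← minimalPeriod_apply_eq α (α.symm i), Equiv.apply_symm_apply]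

/-- The vertex permutation of the associated two-colored map, on black points `inl i` and white
points `inr i'`: it keeps the cycles of `σ`, and has a cycle `(i', k', j')` for each `3`-cycle
`(i, j, k)` of `α`. -/
def assocVertexPerm {P : Type*} [Finite P] (σ α : Perm P) : Perm (P ⊕ White α) :=
  Perm.sumCongr σ
    ((α.subtypePerm (p := fun i => Function.minimalPeriod α i = 3)
      (fun i => by rw [minimalPeriod_apply_eq]))⁻¹)

open Classical in
/-- The edge permutation of the associated two-colored map: it exchanges `i` and `i'` for every
point `i` on a `3`-cycle of `α`, and keeps the other cycles of `α` (which are `2`-cycles and fixed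
points when `α` has short hyperedges). -/
def assocEdgePerm {P : Type*} [Finite P] (α : Perm P) : Perm (P ⊕ White α) where
  toFun := Sum.elim
    (fun i => if h : Function.minimalPeriod α i = 3 then Sum.inr ⟨i, h⟩ else Sum.inl (α i))
    (fun w => Sum.inl w.1)
  invFun := Sum.elim
    (fun i => if h : Function.minimalPeriod α i = 3 then Sum.inr ⟨i, h⟩ else Sum.inl (α.symm i))
    (fun w => Sum.inl w.1)
  left_inv := by
    rintro (i | ⟨i, hi⟩)
    · by_cases h : Function.minimalPeriod α i = 3
      · simp [h]
      · simp [h, minimalPeriod_apply_eq]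
    · simp [hi]
  right_inv := by
    rintro (i | ⟨i, hi⟩)
    · by_cases h : Function.minimalPeriod α i = 3
      · simp [h]
      · simp [h, minimalPeriod_symm_apply_eq]
    · simp [hi]

theorem eq_or_eq_apply_of_sameCycle {Q : Type*} {A : Perm Q} {p q : Q}
    (hp : A (A p) = p) (h : A.SameCycle p q) : q = p ∨ q = A p := by
  obtain ⟨k, rfl⟩ := h
  have h2 : ((A ^ (2 : ℤ)) p) = p := by
    rw [show (2 : ℤ) = 1 + 1 from rfl, zpow_add, zpow_one, Perm.mul_apply, hp]
  rcases Int.even_or_odd' k with ⟨m, rfl | rfl⟩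
  · left
    rw [zpow_mul]
    exact Perm.zpow_apply_eq_self_of_apply_eq_self h2 m
  · right
    rw [add_comm, zpow_add, zpow_one, Perm.mul_apply, zpow_mul,
      Perm.zpow_apply_eq_self_of_apply_eq_self h2 m]

/-- The underlying (multi)graph of a map `(S, A)`: its vertices are the cycles of `S`, its edges
are the `2`-cycles `(p, A p)` of `A`, and such an edge joins the cycle of `S` containing `p` to the
cycle of `S` containing `A p`. Fixed points of `A` (buds) give no edges. -/
def underlyingGraph {Q : Type*} (S A : Perm Q) : Graph (Cycles S) (Cycles A) where
  vertexSet := Set.univ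
  IsLink e x y := ∃ p : Q, A p ≠ p ∧ A (A p) = p ∧
    e = cycleAt A p ∧ x = cycleAt S p ∧ y = cycleAt S (A p)
  isLink_symm := by
    refine fun e he => ⟨fun x y => ?_⟩
    rintro ⟨p, h1, h2, rfl, rfl, rfl⟩
    refine ⟨A p, ?_, by rw [h2], ?_, rfl, by rw [h2]⟩
    · rw [h2]; exact h1.symm
    · exact Quotient.sound (Perm.sameCycle_apply_right.2 (Perm.SameCycle.refl A p))
  eq_or_eq_of_isLink_of_isLink := by
    rintro e x y v w ⟨p, h1, h2, rfl, rfl, rfl⟩ ⟨q, h3, h4, h5, rfl, rfl⟩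
    have h : A.SameCycle p q := Quotient.exact h5
    rcases eq_or_eq_apply_of_sameCycle h2 h with rfl | rfl
    · left; rfl
    · right; rw [h2]
  left_mem_of_isLink := fun _ _ _ _ => Set.mem_univ _

/-- The associated two-colored graph `G(σ, α)`. -/
def assocGraph {P : Type*} [Finite P] (σ α : Perm P) :
    Graph (Cycles (assocVertexPerm σ α)) (Cycles (assocEdgePerm α)) :=
  underlyingGraph (assocVertexPerm σ α) (assocEdgePerm α)

/-- The set `W(σ, α)` of white vertices of `G(σ, α)`: the cycles consisting of white points. -/
def whiteVertices {P : Type*} [Finite P] (σ α : Perm P) :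
    Set (Cycles (assocVertexPerm σ α)) :=
  Set.range fun w : White α => cycleAt (assocVertexPerm σ α) (Sum.inr w)

/-- A multigraph is connected if it has a vertex and any two vertices are joined by a walk. -/
def GraphConnected {V E : Type*} (G : Graph V E) : Prop :=
  G.vertexSet.Nonempty ∧
    ∀ x ∈ G.vertexSet, ∀ y ∈ G.vertexSet, Relation.ReflTransGen G.Adj x y

/-- A multigraph is acyclic if it contains no cycle, that is, no cyclic sequence of `m + 1 ≥ 1`
distinct vertices and `m + 1` distinct edges in which the `i`-th edge joins the `i`-th vertex to
the next one, indices being read modulo `m + 1`. Loops are cycles with `m = 0`, pairs of parallel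
edges are cycles with `m = 1`. -/
def GraphAcyclic {V E : Type*} (G : Graph V E) : Prop :=
  ¬ ∃ (m : ℕ) (v : Fin (m + 1) → V) (e : Fin (m + 1) → E),
    Function.Injective v ∧ Function.Injective e ∧ ∀ i, G.IsLink (e i) (v i) (v (i + 1))

/-- A tree is a connected acyclic multigraph. -/
def IsTree {V E : Type*} (G : Graph V E) : Prop := GraphConnected G ∧ GraphAcyclic G

/-- `s(G)`: the number of spanning trees of `G`, that is, of subgraphs of `G` that contain all
vertices of `G` and are trees. -/
def numSpanningTrees {V E : Type*} (G : Graph V E) : ℕ :=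
  Nat.card {T : Graph V E // T.IsSpanningSubgraph G ∧ IsTree T}

end

end Hypermap

namespace Hypermap

open Equiv

/-! A subgraph of the associated graph is encoded by the set `B` of black points on its edges. An
edge `(i, i')` contributes the single point `i`; an edge coming from a 2-cycle of `α` contributes
both its points, so `B` has to be admissible. Dropping the white vertices that `B` misses, a pair of
a set `S` of white vertices and a spanning tree of the graph without `S` is the same as an
admissible `B` whose trace graph is a tree, and `S` is then the set of skipped vertices
(`numSpanningTrees_induce`).

Let `θ` be the first-return permutation of `α` to `B`. All points of `B` on one 3-cycle are joined
through their white vertex, just as they lie on one cycle of `θ`; hence the trace graph is connected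
exactly when `σ` and `θ` generate a transitive group. Counting edges and vertices turns "one edge
less than vertices" into `z σ + z θ = |P| + 1`. For a transitive pair this is equivalent to having
one face and genus zero, so the trace graph is a tree exactly when `θ` gives a spanning hypertree
(`isTree_traceGraph_iff`).

Several `B` give the same `θ`. On a 3-cycle of `α`, genus zero excludes only the inverse rotation,
and each allowed non-trivial restriction of `θ` determines `B` there: it is the set of moved points.
The trivial restriction comes from the empty set, where the white vertex is skipped and contributes
the factor `-2`, and from three singletons, where it is a leaf and contributes `1`. As `-2 + 3 = 1`,
each hypertree is counted with total weight one (`isTraceOf_iff`, `sum_isTraceOf`). -/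

/-! ### Merging two classes of an equivalence relation. -/

/-- The finest equivalence relation that is coarser than `r` and relates `x` to `y`. -/
def joinPair {X : Type*} (r : Setoid X) (x y : X) : Setoid X where
  r a b := r a b ∨ (r a x ∧ r y b) ∨ (r a y ∧ r x b)
  iseqv := by
    refine ⟨fun a => Or.inl (r.refl' a), fun {a b} h => ?_, fun {a b c} h h' => ?_⟩
    · rcases h with h | ⟨h, h'⟩ | ⟨h, h'⟩
      · exact Or.inl (r.symm' h)
      · exact Or.inr (Or.inr ⟨r.symm' h', r.symm' h⟩)
      · exact Or.inr (Or.inl ⟨r.symm' h', r.symm' h⟩)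
    · rcases h with h | ⟨h1, h2⟩ | ⟨h1, h2⟩ <;> rcases h' with h' | ⟨h3, h4⟩ | ⟨h3, h4⟩
      · exact Or.inl (r.trans' h h')
      · exact Or.inr (Or.inl ⟨r.trans' h h3, h4⟩)
      · exact Or.inr (Or.inr ⟨r.trans' h h3, h4⟩)
      · exact Or.inr (Or.inl ⟨h1, r.trans' h2 h'⟩)
      · exact Or.inr (Or.inl ⟨h1, h4⟩)
      · exact Or.inl (r.trans' h1 h4)
      · exact Or.inr (Or.inr ⟨h1, r.trans' h2 h'⟩)
      · exact Or.inl (r.trans' h1 h4)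
      · exact Or.inr (Or.inr ⟨h1, h4⟩)

theorem joinPair_le_iff {X : Type*} {r s : Setoid X} {x y : X} :
    joinPair r x y ≤ s ↔ r ≤ s ∧ s x y := by
  constructor
  · intro h
    exact ⟨fun a b hab => h (Or.inl hab),
      h (Or.inr (Or.inl ⟨r.refl' x, r.refl' y⟩))⟩
  · rintro ⟨h, hxy⟩ a b (hab | ⟨h1, h2⟩ | ⟨h1, h2⟩)
    · exact h hab
    · exact s.trans' (h h1) (s.trans' hxy (h h2))
    · exact s.trans' (h h1) (s.trans' (s.symm' hxy) (h h2))

theorem joinPair_eq_self {X : Type*} {r : Setoid X} {x y : X} (h : r x y) : joinPair r x y = r :=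
  le_antisymm (joinPair_le_iff.2 ⟨le_rfl, h⟩) (joinPair_le_iff.1 le_rfl).1

theorem sup_joinPair {X : Type*} (r s : Setoid X) (x y : X) :
    r ⊔ joinPair s x y = joinPair (r ⊔ s) x y := by
  refine eq_of_forall_ge_iff fun t => ?_
  rw [sup_le_iff, joinPair_le_iff, joinPair_le_iff, sup_le_iff, and_assoc]

/-- Relating two points from different classes lowers the number of classes by one. -/
theorem card_quotient_joinPair {X : Type*} [Finite X] {r : Setoid X} {x y : X} (h : ¬ r x y) :
    Nat.card (Quotient (joinPair r x y)) + 1 = Nat.card (Quotient r) := by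
  have hle : r ≤ joinPair r x y := (joinPair_le_iff.1 le_rfl).1
  let f : {q : Quotient r // q ≠ ⟦y⟧} → Quotient (joinPair r x y) :=
    fun q => Setoid.map_of_le hle q.1
  have hf : Function.Bijective f := by
    constructor
    · rintro ⟨a, ha⟩ ⟨b, hb⟩ hab
      induction a using Quotient.inductionOn with | _ a
      induction b using Quotient.inductionOn with | _ b
      have hab' : joinPair r x y a b := Quotient.exact hab
      apply Subtype.ext
      rcases hab' with h1 | ⟨h1, h2⟩ | ⟨h1, h2⟩
      · exact Quotient.sound h1
      · exact absurd (Quotient.sound (r.symm' h2)) hb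
      · exact absurd (Quotient.sound h1) ha
    · intro q
      induction q using Quotient.inductionOn with | _ a
      by_cases ha : r a y
      · refine ⟨⟨⟦x⟧, fun hx => h (Quotient.exact hx)⟩, ?_⟩
        exact Quotient.sound (Or.inr (Or.inl ⟨r.refl' x, r.symm' ha⟩))
      · exact ⟨⟨⟦a⟧, fun hx => ha (Quotient.exact hx)⟩, rfl⟩
  rw [← Nat.card_congr (Equiv.ofBijective f hf)]
  classical
  have := Fintype.ofFinite (Quotient r)
  rw [Nat.card_eq_fintype_card, Nat.card_eq_fintype_card, Fintype.card_subtype_compl,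
    Fintype.card_subtype_eq]
  exact Nat.sub_add_cancel (Fintype.card_pos_iff.2 ⟨⟦y⟧⟩)

theorem card_quotient_le_joinPair {X : Type*} [Finite X] (r : Setoid X) (x y : X) :
    Nat.card (Quotient r) ≤ Nat.card (Quotient (joinPair r x y)) + 1 := by
  by_cases h : r x y
  · rw [joinPair_eq_self h]; exact Nat.le_succ _
  · exact (card_quotient_joinPair h).ge

theorem card_quotient_bot (X : Type*) : Nat.card (Quotient (⊥ : Setoid X)) = Nat.card X :=
  Nat.card_congr Setoid.quotientBotEquiv

theorem card_quotient_eq_one_iff {X : Type*} (r : Setoid X) :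
    Nat.card (Quotient r) = 1 ↔ Nonempty X ∧ r = ⊤ := by
  rw [Nat.card_eq_one_iff_unique, Quotient.subsingleton_iff, nonempty_quotient_iff, and_comm]

/-! ### Cycle counts, transpositions and the face of an extremal connected pair. -/

section Cycles

variable {P : Type*}

theorem cycleSetoid_le_iff {π : Perm P} {s : Setoid P} :
    Perm.SameCycle.setoid π ≤ s ↔ ∀ p, s p (π p) := by
  constructor
  · intro h p
    exact h (Perm.sameCycle_apply_right.2 (Perm.SameCycle.refl π p))
  · rintro h p q ⟨k, rfl⟩
    induction k using Int.induction_on with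
    | zero => exact s.refl' p
    | succ k ih =>
      rw [add_comm, zpow_add, zpow_one, Perm.mul_apply]
      exact s.trans' ih (h _)
    | pred k ih =>
      refine s.trans' ih (s.symm' ?_)
      have := h ((π ^ (-(k : ℤ) - 1)) p)
      rwa [← Perm.mul_apply, ← zpow_one_add, show 1 + (-(k : ℤ) - 1) = -k by ring] at this

theorem cycleSetoid_one : Perm.SameCycle.setoid (1 : Perm P) = ⊥ := by
  rw [eq_bot_iff, cycleSetoid_le_iff]
  exact fun _ => rfl

theorem z_one : z (1 : Perm P) = Nat.card P := by
  rw [z, Cycles, cycleSetoid_one, card_quotient_bot]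

/-- Expresses transitivity in the lattice of equivalence relations, where multiplication by a
transposition acts as `joinPair`. -/
theorem orbitRel_closure_pair (σ θ : Perm P) :
    MulAction.orbitRel (Subgroup.closure {σ, θ} : Subgroup (Perm P)) P =
      Perm.SameCycle.setoid σ ⊔ Perm.SameCycle.setoid θ := by
  apply le_antisymm
  · rintro a b ⟨⟨g, hg⟩, rfl⟩
    set s := Perm.SameCycle.setoid σ ⊔ Perm.SameCycle.setoid θ with hs
    have key : ∀ p, s p (g p) := by
      induction hg using Subgroup.closure_induction with
      | mem x hx =>
        rcases hx with rfl | rfl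
        · exact cycleSetoid_le_iff.1 le_sup_left
        · exact cycleSetoid_le_iff.1 le_sup_right
      | one => exact fun p => s.refl' p
      | mul x y _ _ hx hy => exact fun p => s.trans' (hy p) (hx _)
      | inv x _ hx =>
        intro p
        have := hx (x⁻¹ p)
        rw [← Perm.mul_apply, mul_inv_cancel, Perm.one_apply] at this
        exact s.symm' this
    exact s.symm' (key b)
  · refine sup_le (cycleSetoid_le_iff.2 fun p => Setoid.symm' _ ?_)
      (cycleSetoid_le_iff.2 fun p => Setoid.symm' _ ?_)
    · exact ⟨⟨σ, Subgroup.subset_closure (by simp)⟩, rfl⟩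
    · exact ⟨⟨θ, Subgroup.subset_closure (by simp)⟩, rfl⟩

theorem isHypermap_iff (σ θ : Perm P) :
    IsHypermap σ θ ↔
      Nonempty P ∧ Perm.SameCycle.setoid σ ⊔ Perm.SameCycle.setoid θ = ⊤ := by
  rw [IsHypermap, κ, MulAction.orbitRel.Quotient, orbitRel_closure_pair, card_quotient_eq_one_iff]

theorem not_sameCycle_of_apply_eq_self {π : Perm P} {x y : P} (hx : π x = x) (hxy : x ≠ y) :
    ¬ π.SameCycle x y := by
  rintro ⟨k, hk⟩
  exact hxy (by rw [← hk, Perm.zpow_apply_eq_self_of_apply_eq_self hx])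

variable [Finite P]

/-- Multiplying by a transposition merges the cycles of the two exchanged points. -/
theorem cycleSetoid_swap_mul [DecidableEq P] {π : Perm P} {x y : P} (h : ¬ π.SameCycle x y) :
    Perm.SameCycle.setoid (swap x y * π) = joinPair (Perm.SameCycle.setoid π) x y := by
  set s := Perm.SameCycle.setoid (swap x y * π) with hs
  have hstep : ∀ p, s p (swap x y (π p)) := cycleSetoid_le_iff.1 (le_refl s)
  apply le_antisymm
  · rw [hs, cycleSetoid_le_iff]
    intro p
    have h0 := joinPair_le_iff.1 (le_refl (joinPair (Perm.SameCycle.setoid π) x y))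
    have h1 := cycleSetoid_le_iff.1 h0.1 p
    rw [Perm.mul_apply]
    by_cases hx : π p = x
    · rw [hx, swap_apply_left]; rw [hx] at h1; exact Setoid.trans' _ h1 h0.2
    · by_cases hy : π p = y
      · rw [hy, swap_apply_right]; rw [hy] at h1
        exact Setoid.trans' _ h1 (Setoid.symm' _ h0.2)
      · rwa [swap_apply_of_ne_of_ne hx hy]
  · have hx : ∀ n : ℕ, s x ((π ^ n) x) := by
      intro n
      induction n with
      | zero => exact s.refl' x
      | succ n ih =>
        have h2 := s.trans' ih (hstep _)
        rw [← Perm.mul_apply π, ← pow_succ'] at h2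
        by_cases h3 : (π ^ (n + 1)) x = x
        · rw [h3]
        · rwa [swap_apply_of_ne_of_ne h3] at h2
          rintro h4
          exact h ⟨(n + 1 : ℕ), by rw [zpow_natCast]; exact h4⟩
    have hxy : s x y := by
      -- The predecessor of `x` under `π` is the point that the new permutation sends to `y`.
      have hc : π.SameCycle x (π.symm x) :=
        Perm.sameCycle_symm_apply_right.2 (Perm.SameCycle.refl π x)
      obtain ⟨n, hn⟩ := hc.exists_nat_pow_eq
      have h2 := s.trans' (hx n) (hstep _)
      rwa [hn, apply_symm_apply, swap_apply_left] at h2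
    refine joinPair_le_iff.2 ⟨cycleSetoid_le_iff.2 fun p => ?_, hxy⟩
    have h1 := hstep p
    by_cases hx : π p = x
    · rw [hx, swap_apply_left] at h1; rw [hx]; exact s.trans' h1 (s.symm' hxy)
    · by_cases hy : π p = y
      · rw [hy, swap_apply_right] at h1; rw [hy]; exact s.trans' h1 hxy
      · rwa [swap_apply_of_ne_of_ne hx hy] at h1

theorem z_swap_mul [DecidableEq P] {π : Perm P} {x y : P} (h : ¬ π.SameCycle x y) :
    z (swap x y * π) + 1 = z π := by
  rw [z, Cycles, cycleSetoid_swap_mul h]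
  exact card_quotient_joinPair h

/-- Every permutation is obtained from the identity by successively inserting a fixed point into
a cycle. -/
theorem perm_insert_induction [DecidableEq P] {motive : Perm P → Prop} (one : motive 1)
    (insert : ∀ (π : Perm P) (x y : P), π x = x → x ≠ y → motive π → motive (swap x y * π))
    (π : Perm P) : motive π := by
  have := Fintype.ofFinite P
  induction h : π.support.card using Nat.strong_induction_on generalizing π with | _ n ih
  by_cases hπ : π = 1
  · rw [hπ]; exact one
  · obtain ⟨x, hx⟩ : ∃ x, π x ≠ x := by
      by_contra hne
      push Not at hne
      exact hπ (Perm.ext hne)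
    have h1 := ih _ (h ▸ Perm.card_support_swap_mul hx) (swap x (π x) * π) rfl
    have h2 := insert _ x (π x) (by simp) (Ne.symm hx) h1
    rwa [swap_mul_self_mul] at h2

/-- Equality holds for `θ = 1`. Each insertion of a fixed point costs `θ` one cycle, and costs the
join at most one class. -/
theorem z_add_z_le (σ θ : Perm P) :
    z σ + z θ ≤ Nat.card P +
      Nat.card (Quotient (Perm.SameCycle.setoid σ ⊔ Perm.SameCycle.setoid θ)) := by
  classical
  induction θ using perm_insert_induction with
  | one => rw [z_one, cycleSetoid_one, sup_bot_eq, z, add_comm]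
  | insert θ x y hx hxy ih =>
    have hn := not_sameCycle_of_apply_eq_self hx hxy
    have h1 := z_swap_mul hn
    rw [cycleSetoid_swap_mul hn, sup_joinPair]
    have h2 := card_quotient_le_joinPair (Perm.SameCycle.setoid σ ⊔ Perm.SameCycle.setoid θ) x y
    omega

/-- A connected pair of permutations with the maximal number of cycles has a single face. -/
theorem z_inv_mul_eq_one (σ θ : Perm P)
    (htop : Perm.SameCycle.setoid σ ⊔ Perm.SameCycle.setoid θ = ⊤)
    (hz : z σ + z θ = Nat.card P + 1) : z (θ⁻¹ * σ) = 1 := by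
  classical
  induction θ using perm_insert_induction generalizing σ with
  | one =>
    rw [z_one] at hz
    rw [inv_one, one_mul]
    omega
  | insert θ x y hx hxy ih =>
    have hn := not_sameCycle_of_apply_eq_self hx hxy
    have h1 := z_swap_mul hn
    have hne : Nonempty P := ⟨x⟩
    -- If `σ` already joined `x` and `y`, then `σ` and `θ` would be transitive with `|P| + 2` cycles
    -- in total, against `z_add_z_le`.
    have hσ : ¬ σ.SameCycle x y := by
      intro hσ
      have h2 := z_add_z_le σ θ
      have h3 : Perm.SameCycle.setoid σ ⊔ Perm.SameCycle.setoid θ = ⊤ := by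
        rw [← htop, cycleSetoid_swap_mul hn, sup_joinPair, joinPair_eq_self]
        exact (le_sup_left : Perm.SameCycle.setoid σ ≤ _) hσ
      rw [(card_quotient_eq_one_iff _).2 ⟨hne, h3⟩] at h2
      omega
    have h2 := z_swap_mul hσ
    -- The transposition moves from `θ` to `σ`: the product `θ⁻¹ * σ`, the join and the total number
    -- of cycles do not change.
    have h3 := ih (swap x y * σ) ?_ (by omega)
    · rwa [mul_inv_rev, swap_inv, mul_assoc]
    · rw [cycleSetoid_swap_mul hσ, sup_comm, sup_joinPair, sup_comm, ← sup_joinPair,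
        ← cycleSetoid_swap_mul hn, htop]

end Cycles

/-! ### Finite multigraphs: cycles, components and trees. -/

section Multigraph

variable {V E : Type*}

/-- Being joined by a walk whose edges `e ∈ F` have the ends `u e` and `v e`. -/
def walkSetoid (u v : E → V) (F : Finset E) : Setoid V :=
  Relation.EqvGen.setoid fun a b => ∃ e ∈ F, a = u e ∧ b = v e

theorem walkSetoid_le_iff {u v : E → V} {F : Finset E} {s : Setoid V} :
    walkSetoid u v F ≤ s ↔ ∀ e ∈ F, s (u e) (v e) := by
  constructor
  · intro h e he
    exact h (Relation.EqvGen.rel _ _ ⟨e, he, rfl, rfl⟩)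
  · intro h
    refine Setoid.eqvGen_le ?_
    rintro _ _ ⟨e, he, rfl, rfl⟩
    exact h e he

theorem walkSetoid_empty (u v : E → V) : walkSetoid u v ∅ = ⊥ := by
  rw [eq_bot_iff, walkSetoid_le_iff]
  simp

theorem walkSetoid_insert [DecidableEq E] (u v : E → V) (F : Finset E) (e : E) :
    walkSetoid u v (insert e F) = joinPair (walkSetoid u v F) (u e) (v e) := by
  refine eq_of_forall_ge_iff fun t => ?_
  rw [joinPair_le_iff, walkSetoid_le_iff, walkSetoid_le_iff, Finset.forall_mem_insert, and_comm]

/-- A cycle with distinct vertices and distinct edges, all in `F`. -/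
def HasCycle (u v : E → V) (F : Finset E) : Prop :=
  ∃ (m : ℕ) (c : Fin (m + 1) → V) (e : Fin (m + 1) → E),
    Function.Injective c ∧ Function.Injective e ∧ ∀ i, e i ∈ F ∧
      ((u (e i) = c i ∧ v (e i) = c (i + 1)) ∨ (u (e i) = c (i + 1) ∧ v (e i) = c i))

theorem HasCycle.mono {u v : E → V} {F F' : Finset E} (hF : F ⊆ F') (h : HasCycle u v F) :
    HasCycle u v F' := by
  obtain ⟨m, c, e, hc, he, h⟩ := h
  exact ⟨m, c, e, hc, he, fun i => ⟨hF (h i).1, (h i).2⟩⟩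

theorem exists_path_of_walkSetoid {u v : E → V} {F : Finset E} {a b : V}
    (h : walkSetoid u v F a b) :
    ∃ (m : ℕ) (c : ℕ → V), Set.InjOn c {i | i ≤ m} ∧ c 0 = a ∧ c m = b ∧
      ∀ i < m, ∃ e ∈ F, (u e = c i ∧ v e = c (i + 1)) ∨ (u e = c (i + 1) ∧ v e = c i) := by
  classical
  let G : SimpleGraph V := SimpleGraph.fromRel fun a b => ∃ e ∈ F, a = u e ∧ b = v e
  have hG : walkSetoid u v F ≤ G.reachableSetoid := by
    rw [walkSetoid_le_iff]
    intro e he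
    by_cases huv : u e = v e
    · rw [huv]
    · exact SimpleGraph.Adj.reachable ((SimpleGraph.fromRel_adj _ _ _).2
        ⟨huv, Or.inl ⟨e, he, rfl, rfl⟩⟩)
  obtain ⟨p, hp⟩ := SimpleGraph.Reachable.exists_isPath (hG h : G.Reachable a b)
  refine ⟨p.length, p.getVert, hp.getVert_injOn, p.getVert_zero, p.getVert_length, fun i hi => ?_⟩
  have hadj := p.adj_getVert_succ hi
  rcases ((SimpleGraph.fromRel_adj _ _ _).1 hadj).2 with ⟨e, he, h1, h2⟩ | ⟨e, he, h1, h2⟩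
  · exact ⟨e, he, Or.inl ⟨h1.symm, h2.symm⟩⟩
  · exact ⟨e, he, Or.inr ⟨h1.symm, h2.symm⟩⟩

/-- A path in `F` between the ends of `e₀` is closed up by `e₀`. Vertex-simplicity of the path makes
its edges distinct; a path of length zero gives a loop. -/
theorem hasCycle_insert [DecidableEq E] {u v : E → V} {F : Finset E} {e₀ : E} (he₀ : e₀ ∉ F)
    (h : walkSetoid u v F (u e₀) (v e₀)) : HasCycle u v (insert e₀ F) := by
  obtain ⟨m, c, hc, h0, hm, hlink⟩ := exists_path_of_walkSetoid h
  have : Nonempty E := ⟨e₀⟩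
  choose! e he hends using hlink
  refine ⟨m, fun i => c i, fun i => if (i : ℕ) < m then e i else e₀, ?_, ?_, ?_⟩
  · intro i j hij
    exact Fin.ext (hc (Nat.lt_succ_iff.1 i.2) (Nat.lt_succ_iff.1 j.2) hij)
  · intro i j hij
    dsimp only at hij
    split_ifs at hij with hi hj hj
    · have h1 := hends i hi
      have h2 := hends j hj
      rw [hij] at h1
      have inj : ∀ a b : ℕ, a ≤ m → b ≤ m → c a = c b → a = b := fun a b ha hb hab => hc ha hb hab
      apply Fin.ext
      -- Equal edges have equal ends. Opposite orientations would force `i = j + 1` and `i + 1 = j`.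
      rcases h1 with ⟨h3, h4⟩ | ⟨h3, h4⟩ <;> rcases h2 with ⟨h5, h6⟩ | ⟨h5, h6⟩
      · exact inj _ _ (by omega) (by omega) (h3.symm.trans h5)
      · have h7 := inj _ _ (by omega) (by omega) (h3.symm.trans h5)
        have h8 := inj _ _ (by omega) (by omega) (h4.symm.trans h6)
        omega
      · have h7 := inj _ _ (by omega) (by omega) (h3.symm.trans h5)
        have h8 := inj _ _ (by omega) (by omega) (h4.symm.trans h6)
        omega
      · exact inj _ _ (by omega) (by omega) (h4.symm.trans h6)
    · exact absurd (hij ▸ he i hi) he₀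
    · exact absurd (hij ▸ he j hj) he₀
    · apply Fin.ext; omega
  · intro i
    by_cases hi : (i : ℕ) < m
    · have hs : ((i + 1 : Fin (m + 1)) : ℕ) = i + 1 :=
        Fin.val_add_one_of_lt (Fin.lt_last_iff_ne_last.2 fun h => by simp [h] at hi)
      simp only [hi, if_true, hs]
      exact ⟨Finset.mem_insert_of_mem (he i hi), hends i hi⟩
    · have hl : i = Fin.last m := Fin.ext (by rw [Fin.val_last]; omega)
      subst hl
      simp [h0, hm]

theorem HasCycle.exists_walkSetoid_erase [DecidableEq E] {u v : E → V} {F : Finset E}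
    (h : HasCycle u v F) : ∃ e ∈ F, walkSetoid u v (F.erase e) (u e) (v e) := by
  obtain ⟨m, c, e, hc, he, h⟩ := h
  refine ⟨e (Fin.last m), (h _).1, ?_⟩
  set s := walkSetoid u v (F.erase (e (Fin.last m))) with hs
  have hstep : ∀ i, i ≠ Fin.last m → s (c i) (c (i + 1)) := by
    intro i hi
    have h1 : s (u (e i)) (v (e i)) :=
      walkSetoid_le_iff.1 (le_refl s) _ (Finset.mem_erase.2 ⟨fun h => hi (he h), (h i).1⟩)
    rcases (h i).2 with ⟨h2, h3⟩ | ⟨h2, h3⟩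
    · rwa [h2, h3] at h1
    · rw [h2, h3] at h1; exact s.symm' h1
  have hall : ∀ i, s (c 0) (c i) := by
    intro i
    induction i using Fin.induction with
    | zero => exact s.refl' _
    | succ i ih =>
      have h1 := hstep i.castSucc (Fin.castSucc_lt_last i).ne
      rw [Fin.coeSucc_eq_succ] at h1
      exact s.trans' ih h1
  have h1 := hall (Fin.last m)
  rcases (h (Fin.last m)).2 with ⟨h2, h3⟩ | ⟨h2, h3⟩
  · rw [h2, h3, Fin.last_add_one]; exact s.symm' h1
  · rw [h2, h3, Fin.last_add_one]; exact h1

variable [Finite V]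

theorem card_le_card_quotient_walkSetoid_add (u v : E → V) (F : Finset E) :
    Nat.card V ≤ Nat.card (Quotient (walkSetoid u v F)) + F.card := by
  classical
  induction F using Finset.induction_on with
  | empty => rw [walkSetoid_empty, card_quotient_bot]; exact Nat.le_add_right _ _
  | insert e F he ih =>
    rw [walkSetoid_insert, Finset.card_insert_of_notMem he]
    have := card_quotient_le_joinPair (walkSetoid u v F) (u e) (v e)
    omega

/-- A new edge either joins two components, lowering their number by one, or closes a cycle.
Conversely, deleting a suitable edge of a cycle leaves the components unchanged, so equality for `F`
would violate the general bound for the smaller set. -/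
theorem not_hasCycle_iff (u v : E → V) (F : Finset E) :
    ¬ HasCycle u v F ↔ Nat.card V = Nat.card (Quotient (walkSetoid u v F)) + F.card := by
  classical
  constructor
  · intro h
    induction F using Finset.induction_on with
    | empty => rw [walkSetoid_empty, card_quotient_bot]; rfl
    | insert e F he ih =>
      have h1 : ¬ walkSetoid u v F (u e) (v e) := fun h' => h (hasCycle_insert he h')
      rw [ih fun h' => h (h'.mono (Finset.subset_insert _ _)), walkSetoid_insert,
        Finset.card_insert_of_notMem he, ← card_quotient_joinPair h1]
      omega
  · intro h hcyc
    obtain ⟨e, he, h1⟩ := hcyc.exists_walkSetoid_erase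
    have h2 := card_le_card_quotient_walkSetoid_add u v (F.erase e)
    have h3 : walkSetoid u v F = walkSetoid u v (F.erase e) := by
      rw [← joinPair_eq_self h1, ← walkSetoid_insert, Finset.insert_erase he]
    have h4 := Finset.card_erase_add_one he
    rw [← h3] at h2
    omega

/-- A finite multigraph is a tree if and only if it is connected and has one edge less than
vertices. -/
theorem isTree_iff [Finite E] (T : Graph V E) :
    IsTree T ↔ GraphConnected T ∧ T.edgeSet.ncard + 1 = T.vertexSet.ncard := by
  classical
  have := Fintype.ofFinite E
  choose u v huv using fun e : T.edgeSet => T.exists_isLink_of_mem_edgeSet e.2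
  let u' : T.edgeSet → T.vertexSet := fun e => ⟨u e, (huv e).left_mem⟩
  let v' : T.edgeSet → T.vertexSet := fun e => ⟨v e, (huv e).right_mem⟩
  rw [IsTree]
  refine and_congr_right fun hconn => ?_
  have hacyc : GraphAcyclic T ↔ ¬ HasCycle u' v' Finset.univ := by
    refine not_congr ⟨?_, ?_⟩
    · rintro ⟨m, c, e, hc, he, h⟩
      refine ⟨m, fun i => ⟨c i, (h i).left_mem⟩, fun i => ⟨e i, (h i).edge_mem⟩,
        fun i j hij => hc (congrArg Subtype.val hij),
        fun i j hij => he (congrArg Subtype.val hij), fun i => ⟨Finset.mem_univ _, ?_⟩⟩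
      rcases (huv ⟨e i, (h i).edge_mem⟩).eq_and_eq_or_eq_and_eq (h i) with ⟨h1, h2⟩ | ⟨h1, h2⟩
      · exact Or.inl ⟨Subtype.ext h1, Subtype.ext h2⟩
      · exact Or.inr ⟨Subtype.ext h1, Subtype.ext h2⟩
    · rintro ⟨m, c, e, hc, he, h⟩
      refine ⟨m, fun i => c i, fun i => e i, fun i j hij => hc (Subtype.ext hij),
        fun i j hij => he (Subtype.ext hij), fun i => ?_⟩
      have h0 := huv (e i)
      rcases (h i).2 with ⟨h1, h2⟩ | ⟨h1, h2⟩
      · rw [show u (e i) = c i from congrArg Subtype.val h1,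
          show v (e i) = c (i + 1) from congrArg Subtype.val h2] at h0
        exact h0
      · rw [show u (e i) = c (i + 1) from congrArg Subtype.val h1,
          show v (e i) = c i from congrArg Subtype.val h2] at h0
        exact h0.symm
  have htop : walkSetoid u' v' Finset.univ = ⊤ := by
    rw [Setoid.eq_top_iff]
    set s := walkSetoid u' v' Finset.univ with hs
    have hstep : ∀ e, s (u' e) (v' e) := fun e =>
      walkSetoid_le_iff.1 (le_refl s) e (Finset.mem_univ e)
    have key : ∀ (x : T.vertexSet) (y : V), Relation.ReflTransGen T.Adj x y →
        ∃ hy : y ∈ T.vertexSet, s x ⟨y, hy⟩ := by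
      intro x y hxy
      induction hxy with
      | refl => exact ⟨x.2, s.refl' x⟩
      | tail _ hbc ih =>
        obtain ⟨hb, h1⟩ := ih
        obtain ⟨e, he⟩ := hbc
        refine ⟨he.right_mem, s.trans' h1 ?_⟩
        have h2 := hstep ⟨e, he.edge_mem⟩
        rcases (huv ⟨e, he.edge_mem⟩).eq_and_eq_or_eq_and_eq he with ⟨h3, h4⟩ | ⟨h3, h4⟩
        · convert! h2 using 1 <;> exact Subtype.ext (by simp [u', v', h3, h4])
        · refine s.symm' ?_
          convert! h2 using 1 <;> exact Subtype.ext (by simp [u', v', h3, h4])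
    intro x y
    exact (key x y (hconn.2 x x.2 y y.2)).2
  have hne : Nonempty T.vertexSet := hconn.1.to_subtype
  rw [hacyc, not_hasCycle_iff, (card_quotient_eq_one_iff _).2 ⟨hne, htop⟩, Nat.card_coe_set_eq,
    Finset.card_univ, ← Nat.card_eq_fintype_card, Nat.card_coe_set_eq, add_comm, eq_comm]

end Multigraph

/-! ### First-return permutations when cycles have length at most three. -/

section ShortHyperedges

variable {P : Type*} [Finite P] {α : Perm P}

theorem minimalPeriod_eq_three_iff (hα : HasShortHyperedges α) (p : P) :
    Function.minimalPeriod α p = 3 ↔ α p ≠ p ∧ α (α p) ≠ p := by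
  have hpos : 0 < Function.minimalPeriod α p :=
    Function.minimalPeriod_pos_of_mem_periodicPts (α.injective.mem_periodicPts p)
  have hle := hα p
  have hper := Function.isPeriodicPt_minimalPeriod α p
  constructor
  · intro h
    refine ⟨fun h1 => ?_, fun h1 => ?_⟩
    · have := Function.IsPeriodicPt.minimalPeriod_le (n := 1) one_pos (show (α^[1]) p = p from h1)
      omega
    · have := Function.IsPeriodicPt.minimalPeriod_le (n := 2) two_pos (show (α^[2]) p = p from h1)
      omega
  · rintro ⟨h1, h2⟩
    by_contra h3
    generalize Function.minimalPeriod α p = k at *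
    have hk : k = 1 ∨ k = 2 := by omega
    rcases hk with rfl | rfl
    · exact h1 hper
    · exact h2 hper

theorem apply_apply_apply (hα : HasShortHyperedges α) {p : P} (h : α (α p) ≠ p) :
    α (α (α p)) = p := by
  have h1 : α p ≠ p := fun h1 => h (by rw [h1, h1])
  have h3 := (minimalPeriod_eq_three_iff hα p).2 ⟨h1, h⟩
  have := Function.isPeriodicPt_minimalPeriod α p
  rw [h3] at this
  exact this

theorem sameCycle_iff (hα : HasShortHyperedges α) (p q : P) :
    α.SameCycle p q ↔ q = p ∨ q = α p ∨ q = α (α p) := by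
  constructor
  · intro h
    obtain ⟨n, rfl⟩ := h.exists_nat_pow_eq
    induction n with
    | zero => exact Or.inl rfl
    | succ n ih =>
      rw [pow_succ', Perm.mul_apply]
      have h3 := apply_apply_apply hα (p := p)
      rcases ih ⟨n, by rw [zpow_natCast]⟩ with h | h | h
      · rw [h]; tauto
      · rw [h]; tauto
      · rw [h]
        by_cases h2 : α (α p) = p
        · rw [h2]; tauto
        · left; exact h3 h2
  · rintro (rfl | rfl | rfl)
    · exact Perm.SameCycle.refl _ _
    · exact Perm.sameCycle_apply_right.2 (Perm.SameCycle.refl _ _)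
    · exact Perm.sameCycle_apply_right.2 (Perm.sameCycle_apply_right.2 (Perm.SameCycle.refl _ _))

-- With cycles of length at most three, looking two steps ahead finds the next point of `B`, or
-- shows that `p` is the only one; injectivity is then a finite case check.
open Classical in
theorem returnMap_injective (hα : HasShortHyperedges α) (B : Set P) :
    Function.Injective fun p => if p ∉ B then p else if α p ∈ B then α p else
      if α (α p) ∈ B then α (α p) else p := by
  intro p q h
  have h3p : α (α p) = p ∨ α (α (α p)) = p := or_iff_not_imp_left.2 (apply_apply_apply hα)
  have h3q : α (α q) = q ∨ α (α (α q)) = q := or_iff_not_imp_left.2 (apply_apply_apply hα)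
  have e1 : α p = α q → p = q := fun h => α.injective h
  have e2 : α p = α (α q) → p = α q := fun h => α.injective h
  have e3 : α (α p) = α q → α p = q := fun h => α.injective h
  have e4 : α (α p) = α (α q) → α p = α q := fun h => α.injective h
  dsimp only at h
  grind

open Classical in
/-- The permutation that fixes the points outside `B` and maps each point of `B` to the next
point of `B` on its cycle of `α`. -/
noncomputable def returnPerm (hα : HasShortHyperedges α) (B : Set P) : Perm P :=
  Equiv.ofBijective _ (Finite.injective_iff_bijective.1 (returnMap_injective hα B))

open Classical in
theorem returnPerm_apply (hα : HasShortHyperedges α) (B : Set P) (p : P) :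
    returnPerm hα B p = if p ∉ B then p else if α p ∈ B then α p else
      if α (α p) ∈ B then α (α p) else p := rfl

theorem returnPerm_apply_of_notMem (hα : HasShortHyperedges α) {B : Set P} {p : P} (hp : p ∉ B) :
    returnPerm hα B p = p := by
  rw [returnPerm_apply, if_pos hp]

theorem sameCycle_returnPerm_apply (hα : HasShortHyperedges α) (B : Set P) (p : P) :
    α.SameCycle p (returnPerm hα B p) := by
  rw [sameCycle_iff hα, returnPerm_apply]
  split_ifs <;> tauto

theorem returnPerm_apply_mem (hα : HasShortHyperedges α) {B : Set P} {p : P} (hp : p ∈ B) :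
    returnPerm hα B p ∈ B := by
  rw [returnPerm_apply]
  split_ifs <;> tauto

theorem sameCycle_returnPerm_of_mem (hα : HasShortHyperedges α) {B : Set P} {p q : P}
    (hp : p ∈ B) (hq : q ∈ B) (h : α.SameCycle p q) : (returnPerm hα B).SameCycle p q := by
  have h1 : ∀ n : ℕ, (returnPerm hα B).SameCycle p (((returnPerm hα B) ^ n) p) := fun n =>
    ⟨n, by rw [zpow_natCast]⟩
  have h2 := h1 1
  have h3 := h1 2
  rw [pow_one] at h2
  rw [pow_two, Perm.mul_apply] at h3
  have h4 := Perm.SameCycle.refl (returnPerm hα B) p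
  have h5 := apply_apply_apply hα (p := p)
  have e2 : α (α p) = α p → α p = p := fun h => α.injective h
  rw [sameCycle_iff hα] at h
  simp only [returnPerm_apply] at h2 h3
  grind

/-- The cycles of `returnPerm hα B` are the points outside `B` and the non-empty intersections of
`B` with the cycles of `α`. -/
theorem sameCycle_returnPerm_iff (hα : HasShortHyperedges α) {B : Set P} {p q : P} :
    (returnPerm hα B).SameCycle p q ↔ p = q ∨ (p ∈ B ∧ q ∈ B ∧ α.SameCycle p q) := by
  constructor
  · intro h
    obtain ⟨n, rfl⟩ := h.exists_nat_pow_eq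
    clear h
    induction n with
    | zero => exact Or.inl rfl
    | succ n ih =>
      rw [pow_succ', Perm.mul_apply]
      set q := (returnPerm hα B ^ n) p
      by_cases hq : q ∈ B
      · right
        refine ⟨?_, returnPerm_apply_mem hα hq, ?_⟩
        · rcases ih with h | h
          · rwa [h]
          · exact h.1
        · refine Perm.SameCycle.trans ?_ (sameCycle_returnPerm_apply hα B q)
          rcases ih with h | h
          · rw [h]
          · exact h.2.2
      · rw [returnPerm_apply_of_notMem hα hq]
        exact ih
  · rintro (rfl | ⟨h1, h2, h3⟩)
    · exact Perm.SameCycle.refl _ _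
    · exact sameCycle_returnPerm_of_mem hα h1 h2 h3

end ShortHyperedges

/-! ### Genus under relabelling, and the standard cycles of length one, two and three. -/

section Conjugation

variable {X Y : Type*}

theorem z_permCongr (e : X ≃ Y) (π : Perm X) : z (e.permCongr π) = z π := by
  refine (Nat.card_congr (Quotient.congr e fun a b => ?_)).symm
  have hpow : ∀ k : ℤ, (e.permCongr π) ^ k = e.permCongr (π ^ k) := fun k =>
    (map_zpow e.permCongrHom π k).symm
  change (∃ k : ℤ, (π ^ k) a = b) ↔ ∃ k : ℤ, ((e.permCongr π) ^ k) (e a) = e b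
  simp [hpow, Equiv.permCongr_apply]

theorem genus_permCongr (e : X ≃ Y) (θ γ : Perm X) :
    genus (e.permCongr θ) (e.permCongr γ) = genus θ γ := by
  have h : (e.permCongr γ)⁻¹ * e.permCongr θ = e.permCongr (γ⁻¹ * θ) := by
    have h1 := (map_mul e.permCongrHom γ⁻¹ θ).symm
    rwa [map_inv] at h1
  rw [genus, genus, h, z_permCongr, z_permCongr, z_permCongr, Nat.card_congr e]

theorem genus_eq_zero_iff (θ γ : Perm X) :
    genus θ γ = 0 ↔ z θ + z γ + z (γ⁻¹ * θ) = Nat.card X + 2 := by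
  rw [genus, div_eq_zero_iff]
  constructor
  · rintro (h | h)
    · have : ((z θ + z γ + z (γ⁻¹ * θ) : ℕ) : ℚ) = ((Nat.card X + 2 : ℕ) : ℚ) := by
        push_cast; linarith
      exact_mod_cast this
    · norm_num at h
  · intro h
    left
    have : ((z θ + z γ + z (γ⁻¹ * θ) : ℕ) : ℚ) = ((Nat.card X + 2 : ℕ) : ℚ) := by rw [h]
    push_cast at this
    linarith

instance decidableCycleSetoid [Fintype X] [DecidableEq X] (π : Perm X) :
    DecidableRel (Perm.SameCycle.setoid π) := inferInstanceAs (DecidableRel (Perm.SameCycle π))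

theorem z_eq_card [Fintype X] [DecidableEq X] (π : Perm X) :
    z π = Fintype.card (Quotient (Perm.SameCycle.setoid π)) := by
  rw [z, Nat.card_eq_fintype_card]

theorem genus_finRotate_one (θ : Perm (Fin 1)) : genus θ (finRotate 1) = 0 := by
  rw [genus_eq_zero_iff, z_eq_card, z_eq_card, z_eq_card, Nat.card_fin]
  revert θ
  decide

set_option maxRecDepth 10000 in
theorem genus_finRotate_two (θ : Perm (Fin 2)) : genus θ (finRotate 2) = 0 := by
  rw [genus_eq_zero_iff, z_eq_card, z_eq_card, z_eq_card, Nat.card_fin]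
  revert θ
  decide

-- Of the six permutations only the inverse rotation fails: it has three cycles in the count where
-- five are needed.
set_option maxRecDepth 100000 in
theorem genus_finRotate_three (θ : Perm (Fin 3)) :
    genus θ (finRotate 3) = 0 ↔ ∃ i, θ (finRotate 3 i) ≠ i := by
  rw [genus_eq_zero_iff, z_eq_card, z_eq_card, z_eq_card, Nat.card_fin]
  revert θ
  decide

end Conjugation

/-! ### Refinements as first-return permutations. -/

section Refinement

variable {P : Type*} [Finite P] {α : Perm P}

theorem exists_equiv_fin_cycle (α : Perm P) {x : P} {k : ℕ}
    (hk : Function.minimalPeriod α x = k + 1) :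
    ∃ e : Fin (k + 1) ≃ {y // α.SameCycle x y},
      ∀ i, (e (finRotate (k + 1) i) : P) = α (e i) := by
  have hit : ∀ n : ℕ, (α^[n]) x = (α ^ n) x := fun n => by rw [Perm.iterate_eq_pow]
  let f : Fin (k + 1) → {y // α.SameCycle x y} := fun i =>
    ⟨(α^[(i : ℕ)]) x, (i : ℕ), by rw [zpow_natCast, hit]⟩
  have hf : Function.Bijective f := by
    constructor
    · intro i j hij
      have h1 : (α^[(i : ℕ)]) x = (α^[(j : ℕ)]) x := congrArg Subtype.val hij
      exact Fin.ext ((Function.iterate_eq_iterate_iff_of_lt_minimalPeriod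
        (by rw [hk]; exact i.2) (by rw [hk]; exact j.2)).1 h1)
    · rintro ⟨y, hy⟩
      obtain ⟨n, rfl⟩ := hy.exists_nat_pow_eq
      refine ⟨⟨n % (k + 1), Nat.mod_lt _ (Nat.succ_pos k)⟩, Subtype.ext ?_⟩
      change (α^[n % (k + 1)]) x = (α ^ n) x
      rw [← hk, Function.iterate_mod_minimalPeriod_eq, hit]
  refine ⟨Equiv.ofBijective f hf, fun i => ?_⟩
  change (α^[((finRotate (k + 1) i : Fin (k + 1)) : ℕ)]) x = α ((α^[(i : ℕ)]) x)
  rw [← Function.iterate_succ_apply' α]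
  rcases eq_or_ne i (Fin.last k) with rfl | hi
  · have h : (α^[k + 1]) x = x := hk ▸ Function.iterate_minimalPeriod (f := α) (x := x)
    rw [finRotate_last]
    exact h.symm
  · rw [coe_finRotate_of_ne_last hi]

theorem genus_subtypePerm_iff (hα : HasShortHyperedges α) {θ : Perm P} (x : P)
    (h : ∀ y, α.SameCycle x (θ y) ↔ α.SameCycle x y) :
    genus (θ.subtypePerm (p := fun y => α.SameCycle x y) h)
      (α.subtypePerm (p := fun y => α.SameCycle x y) (fun _ => Perm.sameCycle_apply_right)) = 0 ↔
    (Function.minimalPeriod α x = 3 → ∃ y, α.SameCycle x y ∧ θ (α y) ≠ y) := by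
  have hpos : 0 < Function.minimalPeriod α x :=
    Function.minimalPeriod_pos_of_mem_periodicPts (α.injective.mem_periodicPts x)
  have hle := hα x
  obtain ⟨k, hk⟩ : ∃ k, Function.minimalPeriod α x = k + 1 :=
    ⟨_, (Nat.succ_pred_eq_of_pos hpos).symm⟩
  obtain ⟨e, he⟩ := exists_equiv_fin_cycle α hk
  rw [← genus_permCongr e.symm]
  have hrot : e.symm.permCongr (α.subtypePerm (p := fun y => α.SameCycle x y)
      (fun _ => Perm.sameCycle_apply_right)) = finRotate (k + 1) := by
    ext1 i
    rw [Equiv.permCongr_apply, Equiv.symm_symm, Equiv.symm_apply_eq]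
    exact Subtype.ext (he i).symm
  rw [hrot, hk]
  have hk' : k = 0 ∨ k = 1 ∨ k = 2 := by omega
  rcases hk' with rfl | rfl | rfl
  · exact iff_of_true (genus_finRotate_one _) (by norm_num)
  · exact iff_of_true (genus_finRotate_two _) (by norm_num)
  · rw [genus_finRotate_three]
    simp only [Nat.reduceAdd, forall_const]
    have key : ∀ i, e.symm.permCongr (θ.subtypePerm (p := fun y => α.SameCycle x y) h)
        (finRotate 3 i) = i ↔ θ (α (e i)) = e i := by
      intro i
      rw [Equiv.permCongr_apply, Equiv.symm_symm, Equiv.symm_apply_eq, ← he i, Subtype.ext_iff]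
      rfl
    constructor
    · rintro ⟨i, hi⟩
      exact ⟨e i, (e i).2, fun h' => hi ((key i).2 h')⟩
    · rintro ⟨y, hy, hy'⟩
      refine ⟨e.symm ⟨y, hy⟩, fun h' => hy' ?_⟩
      have := (key _).1 h'
      rwa [Equiv.apply_symm_apply] at this

/-- Genus zero is automatic on cycles of length one and two; on a 3-cycle it only says that `θ` is
not the inverse of `α` there. -/
theorem isRefinement_iff (hα : HasShortHyperedges α) (θ : Perm P) :
    IsRefinement θ α ↔ (∀ p, α.SameCycle p (θ p)) ∧
      ∀ x, Function.minimalPeriod α x = 3 → ∃ y, α.SameCycle x y ∧ θ (α y) ≠ y := by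
  constructor
  · rintro ⟨h, hg⟩
    exact ⟨fun p => (h p p).2 (Perm.SameCycle.refl _ _),
      fun x => (genus_subtypePerm_iff hα x (h x)).1 (hg x)⟩
  · rintro ⟨h, hg⟩
    have h' : ∀ x y : P, α.SameCycle x (θ y) ↔ α.SameCycle x y := fun x y =>
      ⟨fun hxy => hxy.trans (h y).symm, fun hxy => hxy.trans (h y)⟩
    exact ⟨h', fun x => (genus_subtypePerm_iff hα x (h' x)).2 (hg x)⟩

/-- A set of points without fixed points of `α` that contains no point or both points of each
`2`-cycle of `α`. -/
def IsAdmissible (α : Perm P) (B : Set P) : Prop :=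
  ∀ p ∈ B, α p ≠ p ∧ (α (α p) = p → α p ∈ B)

theorem isRefinement_returnPerm (hα : HasShortHyperedges α) (B : Set P) :
    IsRefinement (returnPerm hα B) α := by
  rw [isRefinement_iff hα]
  refine ⟨sameCycle_returnPerm_apply hα B, fun x hx => ?_⟩
  obtain ⟨h1, h2⟩ := (minimalPeriod_eq_three_iff hα x).1 hx
  have h3 := apply_apply_apply hα h2
  by_contra! hne
  have e0 := hne x ((sameCycle_iff hα _ _).2 (by tauto))
  have e1 := hne (α x) ((sameCycle_iff hα _ _).2 (by tauto))
  have e2 := hne (α (α x)) ((sameCycle_iff hα _ _).2 (by tauto))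
  have hn : α (α x) ≠ α x := fun h => h1 (α.injective h)
  rw [returnPerm_apply] at e0 e1 e2
  grind

/-- The sets `B` for which `returnPerm` gives a prescribed refinement `θ`: they consist of the
points moved by `θ` and of at most one point of each `3`-cycle of `α` that `θ` fixes pointwise. -/
def IsTraceOf (α θ : Perm P) (B : Set P) : Prop :=
  (∀ p, θ p ≠ p → p ∈ B) ∧ ∀ p ∈ B, θ p = p →
    Function.minimalPeriod α p = 3 ∧ ∀ q ∈ B, α.SameCycle p q → q = p

/-- Describes the fibre of `returnPerm` over a refinement: moved points are forced into `B`, and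
freedom remains only on the 3-cycles that `θ` fixes pointwise. -/
theorem isTraceOf_iff (hα : HasShortHyperedges α) {θ : Perm P} (hθ : IsRefinement θ α) (B : Set P) :
    IsTraceOf α θ B ↔ IsAdmissible α B ∧ returnPerm hα B = θ := by
  obtain ⟨hcyc, hrot⟩ := (isRefinement_iff hα θ).1 hθ
  constructor
  · rintro ⟨h1, h2⟩
    have hadm : IsAdmissible α B := by
      intro p hp
      have hc := (sameCycle_iff hα _ _).1 (hcyc p)
      by_cases hfix : θ p = p
      · obtain ⟨h3, h4⟩ := (minimalPeriod_eq_three_iff hα p).1 (h2 p hp hfix).1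
        exact ⟨h3, fun h => absurd h h4⟩
      · refine ⟨fun h => hfix ?_, fun h => h1 _ fun h' => hfix ?_⟩
        · rw [h, h] at hc; tauto
        -- Here `θ` moves `p` on a 2-cycle, so it cannot fix the other point.
        · have : θ p = α p := by rw [h] at hc; tauto
          rw [this, ← θ.injective.eq_iff, h', this]
    refine ⟨hadm, Perm.ext fun p => ?_⟩
    by_cases hp : p ∈ B
    · by_cases hfix : θ p = p
      · rw [hfix]
        exact (h2 p hp hfix).2 _ (returnPerm_apply_mem hα hp) (sameCycle_returnPerm_apply hα B p)
      · have hmem : θ p ∈ B := h1 _ fun h => hfix (θ.injective h)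
        have hc := (sameCycle_iff hα _ _).1 (hcyc p)
        rw [returnPerm_apply, if_neg (not_not.2 hp)]
        rcases hc with hc | hc | hc
        · exact absurd hc hfix
        · rw [if_pos (hc ▸ hmem), hc]
        · by_cases h4 : α (α p) = p
          · exact absurd (hc.trans h4) hfix
          have h5 := apply_apply_apply hα h4
          rw [if_neg, if_pos (hc ▸ hmem), hc]
          -- Here `θ p = α (α p)` although `α p` lies in `B`. Then `θ` moves `α p` as well, which
          -- forces `θ` to be the inverse rotation on this 3-cycle, the one case excluded by `hrot`.
          intro hαp
          have h7 : α p ≠ p := (hadm p hp).1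
          have h6 : θ (α p) ≠ α p := fun h => h7 ((h2 _ hαp h).2 p hp
            (Perm.sameCycle_apply_left.2 (Perm.SameCycle.refl _ _))).symm
          have h8 : θ (α p) ≠ α (α p) := fun h => h7 (θ.injective (h.trans hc.symm))
          have h9 : θ (α p) = p := by
            have := (sameCycle_iff hα _ _).1 (hcyc (α p))
            rw [h5] at this
            tauto
          have h10 : θ (α (α p)) = α p := by
            have := (sameCycle_iff hα _ _).1 (hcyc (α (α p)))
            rw [h5] at this
            rcases this with h | h | h
            · exact absurd (θ.injective (h.trans hc.symm)) h4
            · exact absurd (α.injective (θ.injective (h.trans h9.symm))) h7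
            · exact h
          obtain ⟨y, hy, hy'⟩ := hrot p ((minimalPeriod_eq_three_iff hα p).2 ⟨h7, h4⟩)
          rcases (sameCycle_iff hα _ _).1 hy with rfl | rfl | rfl
          · exact hy' h9
          · exact hy' h10
          · rw [h5] at hy'; exact hy' hc
    · rw [returnPerm_apply_of_notMem hα hp]
      by_contra h
      exact hp (h1 p (Ne.symm h))
  · rintro ⟨hadm, rfl⟩
    refine ⟨fun p hp => ?_, fun p hp hfix => ?_⟩
    · by_contra h
      exact hp (returnPerm_apply_of_notMem hα h)
    · have hq : ∀ q ∈ B, α.SameCycle p q → q = p := by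
        intro q hq hpq
        obtain ⟨k, hk⟩ := sameCycle_returnPerm_of_mem hα hp hq hpq
        rw [← hk, Perm.zpow_apply_eq_self_of_apply_eq_self hfix]
      -- A 2-cycle is impossible: admissibility would put its other point in `B` too, and `p` is the
      -- only point of `B` on its cycle.
      refine ⟨(minimalPeriod_eq_three_iff hα p).2 ⟨(hadm p hp).1, fun h => (hadm p hp).1 ?_⟩, hq⟩
      exact hq _ ((hadm p hp).2 h) (Perm.sameCycle_apply_right.2 (Perm.SameCycle.refl _ _))

end Refinement

/-! ### White vertices and the weighted count of traces. -/

section AssociatedGraph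

variable {P : Type*} [Finite P] (σ α : Perm P)

theorem assocVertexPerm_zpow_inl (k : ℤ) (p : P) :
    (assocVertexPerm σ α ^ k) (Sum.inl p) = Sum.inl ((σ ^ k) p) := by
  have h := map_zpow (Perm.sumCongrHom P (White α)) (σ, (α.subtypePerm
    (p := fun i => Function.minimalPeriod α i = 3) (fun i => by rw [minimalPeriod_apply_eq]))⁻¹) k
  exact (congrArg (fun π : Perm (P ⊕ White α) => π (Sum.inl p)) h).symm

theorem assocVertexPerm_zpow_inr (k : ℤ) (w : White α) :
    (assocVertexPerm σ α ^ k) (Sum.inr w) = Sum.inr (((α.subtypePerm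
      (p := fun i => Function.minimalPeriod α i = 3)
      (fun i => by rw [minimalPeriod_apply_eq]))⁻¹ ^ k) w) := by
  have h := map_zpow (Perm.sumCongrHom P (White α)) (σ, (α.subtypePerm
    (p := fun i => Function.minimalPeriod α i = 3) (fun i => by rw [minimalPeriod_apply_eq]))⁻¹) k
  exact (congrArg (fun π : Perm (P ⊕ White α) => π (Sum.inr w)) h).symm

theorem cycleAt_inl_eq_iff (p q : P) :
    cycleAt (assocVertexPerm σ α) (Sum.inl p) = cycleAt (assocVertexPerm σ α) (Sum.inl q) ↔
      σ.SameCycle p q := by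
  rw [Quotient.eq]
  change (∃ k : ℤ, _) ↔ ∃ k : ℤ, _
  simp only [assocVertexPerm_zpow_inl, Sum.inl.injEq]

theorem cycleAt_inr_eq_iff (v w : White α) :
    cycleAt (assocVertexPerm σ α) (Sum.inr v) = cycleAt (assocVertexPerm σ α) (Sum.inr w) ↔
      α.SameCycle v w := by
  rw [Quotient.eq]
  change (∃ k : ℤ, _) ↔ _
  simp only [assocVertexPerm_zpow_inr, Sum.inr.injEq]
  change Perm.SameCycle _⁻¹ _ _ ↔ _
  rw [Perm.sameCycle_inv, Perm.sameCycle_subtypePerm]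

theorem cycleAt_inl_ne_inr (p : P) (w : White α) :
    cycleAt (assocVertexPerm σ α) (Sum.inl p) ≠ cycleAt (assocVertexPerm σ α) (Sum.inr w) := by
  intro h
  obtain ⟨k, hk⟩ := Quotient.exact h
  rw [assocVertexPerm_zpow_inl] at hk
  exact Sum.inl_ne_inr hk

/-- The white copy of `p` exists and lies on the vertex `w` of the associated graph. -/
def IsOnWhite (w : Cycles (assocVertexPerm σ α)) (p : P) : Prop :=
  ∃ h : Function.minimalPeriod α p = 3, w = cycleAt (assocVertexPerm σ α) (Sum.inr ⟨p, h⟩)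

/-- The white vertices none of whose points is a copy of a point of `B`. -/
def skippedVertices (B : Set P) : Set (Cycles (assocVertexPerm σ α)) :=
  {w | w ∈ whiteVertices σ α ∧ ∀ p, IsOnWhite σ α w p → p ∉ B}

variable {σ α}

theorem IsOnWhite.sameCycle {w : Cycles (assocVertexPerm σ α)} {p q : P}
    (hp : IsOnWhite σ α w p) (hq : IsOnWhite σ α w q) : α.SameCycle p q := by
  obtain ⟨h, rfl⟩ := hp
  obtain ⟨h', hw⟩ := hq
  exact (cycleAt_inr_eq_iff σ α _ _).1 hw

theorem minimalPeriod_eq_of_sameCycle {p q : P} (h : α.SameCycle p q) :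
    Function.minimalPeriod α q = Function.minimalPeriod α p := by
  obtain ⟨n, rfl⟩ := h.exists_nat_pow_eq
  clear h
  induction n with
  | zero => rfl
  | succ n ih => rw [pow_succ', Perm.mul_apply, minimalPeriod_apply_eq, ih]

theorem IsOnWhite.of_sameCycle {w : Cycles (assocVertexPerm σ α)} {p q : P}
    (hp : IsOnWhite σ α w p) (h : α.SameCycle p q) : IsOnWhite σ α w q := by
  obtain ⟨h', rfl⟩ := hp
  exact ⟨(minimalPeriod_eq_of_sameCycle h).trans h', (cycleAt_inr_eq_iff σ α _ _).2 h⟩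

theorem IsOnWhite.unique {w w' : Cycles (assocVertexPerm σ α)} {p : P}
    (hp : IsOnWhite σ α w p) (hp' : IsOnWhite σ α w' p) : w = w' := by
  obtain ⟨h, rfl⟩ := hp
  obtain ⟨h', rfl⟩ := hp'
  rfl

theorem IsOnWhite.mem_whiteVertices {w : Cycles (assocVertexPerm σ α)} {p : P}
    (hp : IsOnWhite σ α w p) : w ∈ whiteVertices σ α := by
  obtain ⟨h, rfl⟩ := hp
  exact ⟨_, rfl⟩

theorem exists_isOnWhite {w : Cycles (assocVertexPerm σ α)} (hw : w ∈ whiteVertices σ α) :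
    ∃ p, IsOnWhite σ α w p := by
  obtain ⟨⟨p, h⟩, rfl⟩ := hw
  exact ⟨p, h, rfl⟩

theorem not_isOnWhite_inl (p q : P) :
    ¬ IsOnWhite σ α (cycleAt (assocVertexPerm σ α) (Sum.inl p)) q := by
  rintro ⟨h, h'⟩
  exact cycleAt_inl_ne_inr σ α _ _ h'

theorem card_isOnWhite [Fintype P] (hα : HasShortHyperedges α)
    {w : Cycles (assocVertexPerm σ α)} (hw : w ∈ whiteVertices σ α)
    [DecidablePred (IsOnWhite σ α w)] :
    (Finset.univ.filter (IsOnWhite σ α w)).card = 3 := by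
  classical
  obtain ⟨p, hp⟩ := exists_isOnWhite hw
  obtain ⟨h1, h2⟩ := (minimalPeriod_eq_three_iff hα p).1 hp.1
  have : Finset.univ.filter (IsOnWhite σ α w) = {p, α p, α (α p)} := by
    ext q
    simp only [Finset.mem_filter, Finset.mem_univ, true_and, Finset.mem_insert,
      Finset.mem_singleton]
    rw [← sameCycle_iff hα]
    exact ⟨fun hq => hp.sameCycle hq, fun hq => hp.of_sameCycle hq⟩
  rw [this, Finset.card_eq_three]
  exact ⟨p, α p, α (α p), h1.symm, h2.symm, fun h => h1 (α.injective h).symm, rfl⟩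

/-- A trace amounts to an independent choice, on each 3-cycle fixed pointwise by `θ`, of no point or
one point, so the sum is a product of factors `-2 + 3 = 1`. -/
theorem sum_isTraceOf [Fintype (Set P)] (hα : HasShortHyperedges α) (θ : Perm P)
    [DecidablePred (IsTraceOf α θ)] :
    ∑ B ∈ Finset.univ.filter (IsTraceOf α θ), (-2 : ℤ) ^ (skippedVertices σ α B).ncard = 1 := by
  classical
  have := Fintype.ofFinite P
  let D := {w : Cycles (assocVertexPerm σ α) //
    w ∈ whiteVertices σ α ∧ ∀ p, IsOnWhite σ α w p → θ p = p}
  have := Fintype.ofFinite D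
  -- For `w` in `D`, `none` means that `w` is skipped (weight `-2`) and `some p` that `p` is its
  -- only point in the trace (weight `1`).
  let t : D → Finset (Option P) := fun w =>
    Finset.insertNone (Finset.univ.filter (IsOnWhite σ α w.1))
  let g : Option P → ℤ := fun o => o.elim (-2) fun _ => 1
  let b : (D → Option P) → Set P := fun f => {p | θ p ≠ p ∨ ∃ w, f w = some p}
  have ht : ∀ f ∈ Fintype.piFinset t, ∀ w p, f w = some p → IsOnWhite σ α w.1 p := by
    intro f hf w p hfw
    have h1 := Fintype.mem_piFinset.1 hf w
    rw [hfw] at h1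
    exact (Finset.mem_filter.1 (Finset.some_mem_insertNone.1 h1)).2
  have hb : ∀ f ∈ Fintype.piFinset t, ∀ (w : D) p, IsOnWhite σ α w.1 p → p ∈ b f →
      f w = some p := by
    intro f hf w p hp hpb
    rcases hpb with h | ⟨w', hw'⟩
    · exact absurd (w.2.2 p hp) h
    · have h1 : w = w' := Subtype.ext (hp.unique (ht f hf w' p hw'))
      rw [h1, hw']
  have hprod : ∏ w : D, ∑ o ∈ t w, g o = 1 := by
    refine Finset.prod_eq_one fun w _ => ?_
    rw [Finset.sum_insertNone]
    simp [g, card_isOnWhite hα w.2.1]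
  rw [Finset.prod_univ_sum] at hprod
  rw [← hprod]
  symm
  refine Finset.sum_nbij b ?_ ?_ ?_ ?_
  · intro f hf
    refine Finset.mem_filter.2 ⟨Finset.mem_univ _, fun p hp => Or.inl hp, ?_⟩
    rintro p (hp | ⟨w, hw⟩) hfix
    · exact absurd hfix hp
    · have hwp := ht f hf w p hw
      refine ⟨hwp.1, fun q hq hpq => ?_⟩
      have h1 := hb f hf w q (hwp.of_sameCycle hpq) hq
      rw [hw] at h1
      exact (Option.some.inj h1).symm
  · have key : ∀ f ∈ Fintype.piFinset t, ∀ f' ∈ Fintype.piFinset t, b f = b f' →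
        ∀ w p, f w = some p → f' w = some p := by
      intro f hf f' hf' hff' w p hw
      exact hb f' hf' w p (ht f hf w p hw) (hff' ▸ Or.inr ⟨w, hw⟩)
    intro f hf f' hf' hff'
    funext w
    exact Option.ext fun p => ⟨key f hf f' hf' hff' w p, key f' hf' f hf hff'.symm w p⟩
  · intro B hB
    obtain ⟨h1, h2⟩ := (Finset.mem_filter.1 hB).2
    let f : D → Option P := fun w =>
      if h : ∃ p, IsOnWhite σ α w.1 p ∧ p ∈ B then some h.choose else none
    have hf : ∀ w p, f w = some p → IsOnWhite σ α w.1 p ∧ p ∈ B := by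
      intro w p hp
      dsimp only [f] at hp
      split_ifs at hp with h
      rw [← Option.some.inj hp]
      exact h.choose_spec
    refine ⟨f, ?_, ?_⟩
    · refine Fintype.mem_piFinset.2 fun w => ?_
      rcases hw : f w with _ | p
      · exact Finset.none_mem_insertNone
      · exact Finset.some_mem_insertNone.2 (Finset.mem_filter.2 ⟨Finset.mem_univ _, (hf w p hw).1⟩)
    · ext p
      constructor
      · rintro (hp | ⟨w, hw⟩)
        · exact h1 p hp
        · exact (hf w p hw).2
      · intro hp
        by_cases hfix : θ p = p
        · obtain ⟨h3, huniq⟩ := h2 p hp hfix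
          have hon : IsOnWhite σ α (cycleAt (assocVertexPerm σ α) (Sum.inr ⟨p, h3⟩)) p := ⟨h3, rfl⟩
          let w : D := ⟨_, hon.mem_whiteVertices, fun q hq => by
            by_contra hne
            have := huniq q (h1 q hne) (hon.sameCycle hq)
            rw [this] at hne
            exact hne hfix⟩
          refine Or.inr ⟨w, ?_⟩
          have hex : ∃ p, IsOnWhite σ α w.1 p ∧ p ∈ B := ⟨p, hon, hp⟩
          have hw : f w = some hex.choose := dif_pos hex
          rw [hw, huniq _ hex.choose_spec.2 (hon.sameCycle hex.choose_spec.1)]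
        · exact Or.inl hfix
  · intro f hf
    -- A white vertex outside `D` carries a point moved by `θ`, hence in the trace, and is never
    -- skipped.
    have hs : skippedVertices σ α (b f) =
        Subtype.val '' ((Finset.univ.filter fun w : D => f w = none : Finset D) : Set D) := by
      ext w
      constructor
      · rintro ⟨hw, hskip⟩
        have hD : ∀ p, IsOnWhite σ α w p → θ p = p := fun p hp => by
          by_contra hne
          exact hskip p hp (Or.inl hne)
        refine ⟨⟨w, hw, hD⟩, ?_, rfl⟩
        rw [Finset.mem_coe, Finset.mem_filter]
        refine ⟨Finset.mem_univ _, ?_⟩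
        rcases hfw : f ⟨w, hw, hD⟩ with _ | p
        · rfl
        · exact absurd (Or.inr ⟨_, hfw⟩) (hskip p (ht f hf _ p hfw))
      · rintro ⟨w, hw, rfl⟩
        rw [Finset.mem_coe, Finset.mem_filter] at hw
        refine ⟨w.2.1, fun p hp hpb => ?_⟩
        have := hb f hf w p hp hpb
        rw [hw.2] at this
        exact absurd this (by simp)
    rw [hs, Set.ncard_image_of_injective _ Subtype.val_injective, Set.ncard_coe_finset,
      ← Finset.prod_const, Finset.prod_filter]
    refine Finset.prod_congr rfl fun w _ => ?_
    rcases f w with _ | p <;> simp [g]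

end AssociatedGraph

theorem ncard_image_eq_of_eq_iff {X Y Z : Type*} {A : Set X} {f : X → Y} {g : X → Z}
    (h : ∀ a ∈ A, ∀ b ∈ A, f a = f b ↔ g a = g b) : (f '' A).ncard = (g '' A).ncard := by
  have h1 : ∀ y ∈ f '' A, ∃ a ∈ A, f a = y := fun y hy => hy
  choose c hc hfc using h1
  refine Set.ncard_congr (fun y hy => g (c y hy)) (fun y hy => ⟨_, hc y hy, rfl⟩) ?_ ?_
  · intro y y' hy hy' hg
    rw [← hfc y hy, ← hfc y' hy']
    exact (h _ (hc y hy) _ (hc y' hy')).2 hg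
  · rintro _ ⟨a, ha, rfl⟩
    have hfa : f a ∈ f '' A := ⟨a, ha, rfl⟩
    exact ⟨f a, hfa, (h _ (hc _ hfa) _ ha).1 (hfc _ hfa)⟩

theorem ncard_range_eq_z {X Y : Type*} (π : Perm X) {f : X → Y}
    (h : ∀ p q, f p = f q ↔ π.SameCycle p q) : (Set.range f).ncard = z π := by
  have h1 : Set.range (cycleAt π) = Set.univ := Set.range_eq_univ.2 Quotient.mk_surjective
  rw [z, ← Set.ncard_univ, ← h1, ← Set.image_univ, ← Set.image_univ]
  exact ncard_image_eq_of_eq_iff fun a _ b _ => (h a b).trans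
    (Quotient.eq (r := Perm.SameCycle.setoid π)).symm

/-! ### Edges of the associated graph. -/

section EdgePerm

variable {P : Type*} [Finite P] {σ α : Perm P}

theorem assocEdgePerm_inl_of_eq {p : P} (h : Function.minimalPeriod α p = 3) :
    assocEdgePerm α (Sum.inl p) = Sum.inr ⟨p, h⟩ := by
  simp [assocEdgePerm, h]

theorem assocEdgePerm_inl_of_ne {p : P} (h : Function.minimalPeriod α p ≠ 3) :
    assocEdgePerm α (Sum.inl p) = Sum.inl (α p) := by
  simp [assocEdgePerm, h]

theorem assocEdgePerm_inr (w : White α) : assocEdgePerm α (Sum.inr w) = Sum.inl w.1 := rfl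

theorem apply_apply_eq_of_minimalPeriod_ne (hα : HasShortHyperedges α) {p : P}
    (h : Function.minimalPeriod α p ≠ 3) : α (α p) = p := by
  by_contra h2
  exact h ((minimalPeriod_eq_three_iff hα p).2 ⟨fun h1 => h2 (by rw [h1, h1]), h2⟩)

theorem assocEdgePerm_apply_apply (hα : HasShortHyperedges α) (x : P ⊕ White α) :
    assocEdgePerm α (assocEdgePerm α x) = x := by
  rcases x with p | w
  · by_cases h : Function.minimalPeriod α p = 3
    · rw [assocEdgePerm_inl_of_eq h, assocEdgePerm_inr]
    · rw [assocEdgePerm_inl_of_ne h, assocEdgePerm_inl_of_ne (by rwa [minimalPeriod_apply_eq]),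
        apply_apply_eq_of_minimalPeriod_ne hα h]
  · rw [assocEdgePerm_inr, assocEdgePerm_inl_of_eq w.2]

theorem cycleAt_assocEdgePerm_apply (x : P ⊕ White α) :
    cycleAt (assocEdgePerm α) (assocEdgePerm α x) = cycleAt (assocEdgePerm α) x :=
  Quotient.sound (Perm.sameCycle_apply_left.2 (Perm.SameCycle.refl _ _))

theorem cycleAt_assocEdgePerm_eq (hα : HasShortHyperedges α) {x y : P ⊕ White α}
    (h : cycleAt (assocEdgePerm α) x = cycleAt (assocEdgePerm α) y) :
    y = x ∨ y = assocEdgePerm α x :=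
  eq_or_eq_apply_of_sameCycle (assocEdgePerm_apply_apply hα x) (Quotient.exact h)

theorem exists_cycleAt_inl (e : Cycles (assocEdgePerm α)) :
    ∃ p : P, e = cycleAt (assocEdgePerm α) (Sum.inl p) := by
  induction e using Quotient.inductionOn with | _ x
  rcases x with p | w
  · exact ⟨p, rfl⟩
  · exact ⟨w.1, (cycleAt_assocEdgePerm_apply (Sum.inr w)).symm⟩

theorem assocEdgePerm_inl_ne {p : P} (h : α p ≠ p) : assocEdgePerm α (Sum.inl p) ≠ Sum.inl p := by
  by_cases h3 : Function.minimalPeriod α p = 3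
  · rw [assocEdgePerm_inl_of_eq h3]; exact Sum.inr_ne_inl
  · rw [assocEdgePerm_inl_of_ne h3]; exact fun h' => h (Sum.inl.inj h')

theorem assocGraph_isLink (hα : HasShortHyperedges α) {p : P} (h : α p ≠ p) :
    (assocGraph σ α).IsLink (cycleAt (assocEdgePerm α) (Sum.inl p))
      (cycleAt (assocVertexPerm σ α) (Sum.inl p))
      (cycleAt (assocVertexPerm σ α) (assocEdgePerm α (Sum.inl p))) :=
  ⟨Sum.inl p, assocEdgePerm_inl_ne h, assocEdgePerm_apply_apply hα _, rfl, rfl, rfl⟩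

theorem apply_ne_of_mem_edgeSet (hα : HasShortHyperedges α) {p : P}
    (h : cycleAt (assocEdgePerm α) (Sum.inl p) ∈ (assocGraph σ α).edgeSet) : α p ≠ p := by
  obtain ⟨x, y, q, h1, h2, h3, -, -⟩ := (assocGraph σ α).exists_isLink_of_mem_edgeSet h
  intro hp
  have hn : Function.minimalPeriod α p ≠ 3 := fun h3 =>
    ((minimalPeriod_eq_three_iff hα p).1 h3).1 hp
  have hfix : assocEdgePerm α (Sum.inl p) = Sum.inl p := by rw [assocEdgePerm_inl_of_ne hn, hp]
  rcases cycleAt_assocEdgePerm_eq hα h3 with rfl | rfl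
  · exact h1 hfix
  · exact h1 (by rw [hfix, hfix])

end EdgePerm

/-! ### Trace graphs, trees and spanning hypertrees. -/

section TraceGraph

variable {P : Type*} [Finite P] {σ α : Perm P}

/-- The subgraph of the associated graph formed by the edges through the points of `B`, without
the white vertices that none of these edges meets. -/
noncomputable def traceGraph (σ α : Perm P) (B : Set P) :
    Graph (Cycles (assocVertexPerm σ α)) (Cycles (assocEdgePerm α)) :=
  ((assocGraph σ α).induce ((assocGraph σ α).vertexSet \ skippedVertices σ α B)).restrict
    ((fun p => cycleAt (assocEdgePerm α) (Sum.inl p)) '' B)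

theorem vertexSet_traceGraph (B : Set P) :
    (traceGraph σ α B).vertexSet = (assocGraph σ α).vertexSet \ skippedVertices σ α B := rfl

theorem mem_vertexSet_traceGraph {B : Set P} {v : Cycles (assocVertexPerm σ α)} :
    v ∈ (traceGraph σ α B).vertexSet ↔ v ∉ skippedVertices σ α B :=
  ⟨fun h => h.2, fun h => ⟨Set.mem_univ _, h⟩⟩

theorem cycleAt_inl_mem_traceGraph (B : Set P) (p : P) :
    cycleAt (assocVertexPerm σ α) (Sum.inl p) ∈ (traceGraph σ α B).vertexSet := by
  rw [mem_vertexSet_traceGraph]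
  rintro ⟨⟨w, hw⟩, -⟩
  exact cycleAt_inl_ne_inr σ α p w hw.symm

theorem cycleAt_inr_mem_traceGraph {B : Set P} {w : White α} (hw : (w : P) ∈ B) :
    cycleAt (assocVertexPerm σ α) (Sum.inr w) ∈ (traceGraph σ α B).vertexSet := by
  rw [mem_vertexSet_traceGraph]
  rintro ⟨-, h⟩
  exact h w ⟨w.2, rfl⟩ hw

theorem traceGraph_isLink (hα : HasShortHyperedges α) {B : Set P} (hB : IsAdmissible α B) {p : P}
    (hp : p ∈ B) :
    (traceGraph σ α B).IsLink (cycleAt (assocEdgePerm α) (Sum.inl p))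
      (cycleAt (assocVertexPerm σ α) (Sum.inl p))
      (cycleAt (assocVertexPerm σ α) (assocEdgePerm α (Sum.inl p))) := by
  refine ⟨⟨p, hp, rfl⟩, assocGraph_isLink hα (hB p hp).1, cycleAt_inl_mem_traceGraph B p, ?_⟩
  by_cases h3 : Function.minimalPeriod α p = 3
  · rw [assocEdgePerm_inl_of_eq h3]
    exact cycleAt_inr_mem_traceGraph hp
  · rw [assocEdgePerm_inl_of_ne h3]
    exact cycleAt_inl_mem_traceGraph B _

theorem exists_of_traceGraph_isLink (hα : HasShortHyperedges α) {B : Set P}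
    (hB : IsAdmissible α B) {e : Cycles (assocEdgePerm α)} {x y : Cycles (assocVertexPerm σ α)}
    (h : (traceGraph σ α B).IsLink e x y) :
    ∃ p ∈ B, e = cycleAt (assocEdgePerm α) (Sum.inl p) ∧
      ((x = cycleAt (assocVertexPerm σ α) (Sum.inl p) ∧
        y = cycleAt (assocVertexPerm σ α) (assocEdgePerm α (Sum.inl p))) ∨
      (x = cycleAt (assocVertexPerm σ α) (assocEdgePerm α (Sum.inl p)) ∧
        y = cycleAt (assocVertexPerm σ α) (Sum.inl p))) := by
  obtain ⟨p, hp, rfl⟩ := h.1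
  exact ⟨p, hp, rfl, h.eq_and_eq_or_eq_and_eq (traceGraph_isLink hα hB hp)⟩

theorem edgeSet_traceGraph (hα : HasShortHyperedges α) {B : Set P} (hB : IsAdmissible α B) :
    (traceGraph σ α B).edgeSet = (fun p => cycleAt (assocEdgePerm α) (Sum.inl p)) '' B := by
  apply Set.Subset.antisymm
  · exact fun e he => he.2
  · rintro _ ⟨p, hp, rfl⟩
    exact (traceGraph_isLink hα hB hp).edge_mem

theorem cycleAt_inl_mem_edgeSet_iff (hα : HasShortHyperedges α) {B : Set P}
    (hB : IsAdmissible α B) {p : P} :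
    cycleAt (assocEdgePerm α) (Sum.inl p) ∈ (traceGraph σ α B).edgeSet ↔ p ∈ B := by
  rw [edgeSet_traceGraph hα hB]
  refine ⟨?_, fun h => ⟨p, h, rfl⟩⟩
  rintro ⟨q, hq, h⟩
  rcases cycleAt_assocEdgePerm_eq hα h with h' | h'
  · rwa [Sum.inl.inj h']
  · by_cases h3 : Function.minimalPeriod α q = 3
    · rw [assocEdgePerm_inl_of_eq h3] at h'
      exact absurd h' Sum.inl_ne_inr
    · rw [assocEdgePerm_inl_of_ne h3] at h'
      rw [Sum.inl.inj h']
      exact (hB q hq).2 (apply_apply_eq_of_minimalPeriod_ne hα h3)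

theorem graphConnected_traceGraph_iff [Nonempty P] (hα : HasShortHyperedges α) {B : Set P}
    (hB : IsAdmissible α B) :
    GraphConnected (traceGraph σ α B) ↔
      Perm.SameCycle.setoid σ ⊔ Perm.SameCycle.setoid (returnPerm hα B) = ⊤ := by
  constructor
  · intro h
    rw [Setoid.eq_top_iff]
    set s := Perm.SameCycle.setoid σ ⊔ Perm.SameCycle.setoid (returnPerm hα B) with hs
    have hσ : ∀ {p q}, σ.SameCycle p q → s p q := fun {p q} h =>
      (le_sup_left : Perm.SameCycle.setoid σ ≤ s) h
    have hθ : ∀ {p q}, (returnPerm hα B).SameCycle p q → s p q := fun {p q} h =>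
      (le_sup_right : Perm.SameCycle.setoid (returnPerm hα B) ≤ s) h
    intro p q
    -- An invariant carried along walks from `p`: a black vertex is judged by its points, a white
    -- one by those of its points that lie in `B`.
    let N : Cycles (assocVertexPerm σ α) → Prop := fun v =>
      (∀ i, v = cycleAt (assocVertexPerm σ α) (Sum.inl i) → s p i) ∧
        ∀ i, IsOnWhite σ α v i → i ∈ B → s p i
    have hNl : ∀ i, N (cycleAt (assocVertexPerm σ α) (Sum.inl i)) ↔ s p i := by
      intro i
      refine ⟨fun h => h.1 i rfl, fun h => ⟨fun j hj => ?_, fun j hj => ?_⟩⟩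
      · exact s.trans' h (hσ ((cycleAt_inl_eq_iff σ α _ _).1 hj))
      · exact absurd hj (not_isOnWhite_inl _ _)
    have hNr : ∀ i (h3 : Function.minimalPeriod α i = 3), i ∈ B →
        (N (cycleAt (assocVertexPerm σ α) (Sum.inr ⟨i, h3⟩)) ↔ s p i) := by
      intro i h3 hi
      refine ⟨fun h => h.2 i ⟨h3, rfl⟩ hi, fun h => ⟨fun j hj => ?_, fun j hj hjB => ?_⟩⟩
      · exact absurd hj.symm (cycleAt_inl_ne_inr σ α _ _)
      · refine s.trans' h (hθ (sameCycle_returnPerm_of_mem hα hi hjB ?_))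
        exact IsOnWhite.sameCycle ⟨h3, rfl⟩ hj
    have hN : ∀ i ∈ B, (N (cycleAt (assocVertexPerm σ α) (Sum.inl i)) ↔
        N (cycleAt (assocVertexPerm σ α) (assocEdgePerm α (Sum.inl i)))) := by
      intro i hi
      by_cases h3 : Function.minimalPeriod α i = 3
      · rw [assocEdgePerm_inl_of_eq h3, hNl, hNr i h3 hi]
      · rw [assocEdgePerm_inl_of_ne h3, hNl, hNl]
        have h4 : s i (α i) := hθ (sameCycle_returnPerm_of_mem hα hi
          ((hB i hi).2 (apply_apply_eq_of_minimalPeriod_ne hα h3))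
          (Perm.sameCycle_apply_right.2 (Perm.SameCycle.refl _ _)))
        exact ⟨fun h => s.trans' h h4, fun h => s.trans' h (s.symm' h4)⟩
    have hreach := h.2 _ (cycleAt_inl_mem_traceGraph B p) _ (cycleAt_inl_mem_traceGraph B q)
    have hall : ∀ v, Relation.ReflTransGen (traceGraph σ α B).Adj
        (cycleAt (assocVertexPerm σ α) (Sum.inl p)) v → N v := by
      intro v hv
      induction hv with
      | refl => exact (hNl p).2 (s.refl' p)
      | tail _ hadj ih =>
        obtain ⟨e, he⟩ := hadj
        obtain ⟨i, hi, -, ⟨rfl, rfl⟩ | ⟨rfl, rfl⟩⟩ := exists_of_traceGraph_isLink hα hB he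
        · exact (hN i hi).1 ih
        · exact (hN i hi).2 ih
    exact (hNl q).1 (hall _ hreach)
  · intro htop
    let R := Relation.ReflTransGen (traceGraph σ α B).Adj
    have hsymm : ∀ {x y}, R x y → R y x := fun {x y} h => by
      induction h with
      | refl => exact .refl
      | tail _ hadj ih => exact ih.head hadj.symm
    let b : P → Cycles (assocVertexPerm σ α) := fun p => cycleAt (assocVertexPerm σ α) (Sum.inl p)
    let s : Setoid P := ⟨fun p q => R (b p) (b q), fun _ => .refl, hsymm, fun h h' => h.trans h'⟩
    have hlink : ∀ i ∈ B, R (b i) (cycleAt (assocVertexPerm σ α) (assocEdgePerm α (Sum.inl i))) :=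
      fun i hi => .single ⟨_, traceGraph_isLink hα hB hi⟩
    -- Two points of `B` on a 3-cycle are linked through their common white vertex, two on a 2-cycle
    -- by its edge.
    have hsame : ∀ i ∈ B, ∀ j ∈ B, α.SameCycle i j → R (b i) (b j) := by
      intro i hi j hj hij
      by_cases h3 : Function.minimalPeriod α i = 3
      · have h1 := hlink i hi
        have h2 := hlink j hj
        have h4 := (minimalPeriod_eq_of_sameCycle hij).trans h3
        rw [assocEdgePerm_inl_of_eq h3] at h1
        rw [assocEdgePerm_inl_of_eq h4] at h2
        have h5 : cycleAt (assocVertexPerm σ α) (Sum.inr ⟨i, h3⟩) =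
          cycleAt (assocVertexPerm σ α) (Sum.inr ⟨j, h4⟩) := (cycleAt_inr_eq_iff σ α _ _).2 hij
        rw [h5] at h1
        exact h1.trans (hsymm h2)
      · have h2 := apply_apply_eq_of_minimalPeriod_ne hα h3
        have h1 := hlink i hi
        rw [assocEdgePerm_inl_of_ne h3] at h1
        rcases (sameCycle_iff hα _ _).1 hij with rfl | rfl | rfl
        · exact .refl
        · exact h1
        · rw [h2]
    have hs : s = ⊤ := by
      rw [eq_top_iff, ← htop, sup_le_iff, cycleSetoid_le_iff, cycleSetoid_le_iff]
      constructor
      · intro p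
        have : b p = b (σ p) := (cycleAt_inl_eq_iff σ α _ _).2
          (Perm.sameCycle_apply_right.2 (Perm.SameCycle.refl _ _))
        change R (b p) (b (σ p))
        rw [← this]
      · intro p
        by_cases hp : p ∈ B
        · exact hsame p hp _ (returnPerm_apply_mem hα hp) (sameCycle_returnPerm_apply hα B p)
        · rw [returnPerm_apply_of_notMem hα hp]
    have hb : ∀ p q, R (b p) (b q) := Setoid.eq_top_iff.1 hs
    obtain ⟨p₀⟩ := (inferInstance : Nonempty P)
    have hv : ∀ v ∈ (traceGraph σ α B).vertexSet, R (b p₀) v := by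
      intro v hv
      induction v using Quotient.inductionOn with | _ x
      rcases x with p | ⟨i, h3⟩
      · exact hb p₀ p
      · rw [mem_vertexSet_traceGraph] at hv
        have : ∃ j, IsOnWhite σ α (cycleAt (assocVertexPerm σ α) (Sum.inr ⟨i, h3⟩)) j ∧ j ∈ B := by
          by_contra! hne
          exact hv ⟨⟨_, rfl⟩, hne⟩
        obtain ⟨j, ⟨hj3, hj⟩, hjB⟩ := this
        have h1 := hlink j hjB
        rw [assocEdgePerm_inl_of_eq hj3, ← hj] at h1
        exact (hb p₀ j).trans h1
    exact ⟨⟨_, cycleAt_inl_mem_traceGraph B p₀⟩, fun x hx y hy => (hsymm (hv x hx)).trans (hv y hy)⟩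

theorem ncard_vertexSet_traceGraph (B : Set P) :
    (traceGraph σ α B).vertexSet.ncard = z σ + ((fun w : White α =>
      cycleAt (assocVertexPerm σ α) (Sum.inr w)) '' {w | (w : P) ∈ B}).ncard := by
  have hV : (traceGraph σ α B).vertexSet =
      (Set.range fun p : P => cycleAt (assocVertexPerm σ α) (Sum.inl p)) ∪
      ((fun w : White α => cycleAt (assocVertexPerm σ α) (Sum.inr w)) '' {w | (w : P) ∈ B}) := by
    ext v
    constructor
    · intro hv
      rw [mem_vertexSet_traceGraph] at hv
      induction v using Quotient.inductionOn with | _ x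
      rcases x with p | ⟨i, h3⟩
      · exact Or.inl ⟨p, rfl⟩
      · have : ∃ j, IsOnWhite σ α (cycleAt (assocVertexPerm σ α) (Sum.inr ⟨i, h3⟩)) j ∧ j ∈ B := by
          by_contra! hne
          exact hv ⟨⟨_, rfl⟩, hne⟩
        obtain ⟨j, ⟨hj3, hj⟩, hjB⟩ := this
        exact Or.inr ⟨⟨j, hj3⟩, hjB, hj.symm⟩
    · rintro (⟨p, rfl⟩ | ⟨w, hw, rfl⟩)
      · exact cycleAt_inl_mem_traceGraph B p
      · exact cycleAt_inr_mem_traceGraph hw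
  rw [hV, Set.ncard_union_eq, ncard_range_eq_z σ (cycleAt_inl_eq_iff σ α)]
  rw [Set.disjoint_left]
  rintro _ ⟨p, rfl⟩ ⟨w, -, hw⟩
  exact cycleAt_inl_ne_inr σ α p w hw.symm

/-- Let `e` be the number of 2-cycles inside `B`, `b` the number of points of `B` on 3-cycles and
`w` the number of white vertices met. Then `θ` has `|P| - |B| + e + w` cycles, there are `e + b`
edges, and `|B| = 2e + b`. -/
theorem z_returnPerm_add_ncard_edgeSet (hα : HasShortHyperedges α) {B : Set P}
    (hB : IsAdmissible α B) :
    z (returnPerm hα B) + (traceGraph σ α B).edgeSet.ncard = Nat.card P + ((fun w : White α =>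
      cycleAt (assocVertexPerm σ α) (Sum.inr w)) '' {w | (w : P) ∈ B}).ncard := by
  classical
  set θ := returnPerm hα B with hθ
  have hcyc : ∀ p q, cycleAt θ p = cycleAt θ q ↔ p = q ∨ (p ∈ B ∧ q ∈ B ∧ α.SameCycle p q) :=
    fun p q => Quotient.eq.trans (sameCycle_returnPerm_iff hα)
  let ε : P → Cycles (assocEdgePerm α) := fun p => cycleAt (assocEdgePerm α) (Sum.inl p)
  let B₂ : Set P := {p | p ∈ B ∧ Function.minimalPeriod α p ≠ 3}
  let B₃ : Set P := {p | p ∈ B ∧ Function.minimalPeriod α p = 3}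
  have hε : ∀ p ∈ B₂, ∀ q, ε p = ε q ↔ q = p ∨ q = α p := by
    intro p hp q
    constructor
    · intro h
      have := cycleAt_assocEdgePerm_eq hα h
      rwa [assocEdgePerm_inl_of_ne hp.2, Sum.inl.injEq, Sum.inl.injEq] at this
    · rintro (rfl | rfl)
      · rfl
      · have := cycleAt_assocEdgePerm_apply (α := α) (Sum.inl p)
        rw [assocEdgePerm_inl_of_ne hp.2] at this
        exact this.symm
  have hε₃ : ∀ p ∈ B₃, ∀ q, ε p = ε q → q = p := by
    intro p hp q h
    have := cycleAt_assocEdgePerm_eq hα h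
    rw [assocEdgePerm_inl_of_eq hp.2] at this
    rcases this with h | h
    · exact Sum.inl.inj h
    · exact absurd h Sum.inl_ne_inr
  have hBB : B = B₂ ∪ B₃ := by
    ext p
    by_cases h3 : Function.minimalPeriod α p = 3 <;> simp [B₂, B₃, h3]
  have hd : Disjoint B₂ B₃ := Set.disjoint_left.2 fun p h h' => h.2 h'.2
  have hα₂ : ∀ p ∈ B₂, α p ∈ B₂ := fun p hp =>
    ⟨(hB p hp.1).2 (apply_apply_eq_of_minimalPeriod_ne hα hp.2),
      by rw [minimalPeriod_apply_eq]; exact hp.2⟩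
  have hF : (traceGraph σ α B).edgeSet.ncard = (ε '' B₂).ncard + B₃.ncard := by
    rw [edgeSet_traceGraph hα hB]
    change (ε '' B).ncard = _
    rw [hBB, Set.image_union, Set.ncard_union_eq, Set.InjOn.ncard_image (s := B₃)]
    · exact fun p hp q _ h => (hε₃ p hp q h).symm
    · rw [Set.disjoint_left]
      rintro _ ⟨p, hp, rfl⟩ ⟨q, hq, h⟩
      exact Set.disjoint_left.1 hd hp (hε₃ q hq p h ▸ hq)
  have hF₂ : B₂.ncard = 2 * (ε '' B₂).ncard := by
    have := Fintype.ofFinite P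
    rw [Set.ncard_eq_toFinset_card', Set.ncard_eq_toFinset_card', Set.toFinset_image,
      Finset.card_eq_sum_card_image ε, Finset.sum_const_nat (m := 2), mul_comm]
    intro e he
    obtain ⟨p, hp, rfl⟩ := Finset.mem_image.1 he
    rw [Set.mem_toFinset] at hp
    rw [Finset.card_eq_two]
    refine ⟨p, α p, (hB p hp.1).1.symm, ?_⟩
    ext q
    rw [Finset.mem_filter, Set.mem_toFinset, Finset.mem_insert, Finset.mem_singleton,
      eq_comm (a := ε q), hε p hp]
    refine ⟨fun h => h.2, fun h => ⟨?_, h⟩⟩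
    rcases h with rfl | rfl
    · exact hp
    · exact hα₂ p hp
  have hz : z θ = Bᶜ.ncard + (cycleAt θ '' B₂).ncard + (cycleAt θ '' B₃).ncard := by
    have hout : ∀ p ∈ Bᶜ, ∀ q, cycleAt θ p = cycleAt θ q → p = q := by
      intro p hp q h
      rcases (hcyc p q).1 h with h | h
      · exact h
      · exact absurd h.1 hp
    have hu : (Set.univ : Set (Cycles θ)) =
        (cycleAt θ '' Bᶜ ∪ cycleAt θ '' B₂) ∪ cycleAt θ '' B₃ := by
      rw [← Set.image_union, ← Set.image_union, Set.union_assoc, ← hBB, Set.compl_union_self,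
        Set.image_univ]
      exact (Set.range_eq_univ.2 Quotient.mk_surjective).symm
    rw [z, ← Set.ncard_univ, hu, Set.ncard_union_eq, Set.ncard_union_eq,
      Set.InjOn.ncard_image (s := Bᶜ)]
    · exact fun p hp q _ h => hout p hp q h
    · rw [Set.disjoint_left]
      rintro _ ⟨p, hp, rfl⟩ ⟨q, hq, h⟩
      exact hp (hout p hp q h.symm ▸ hq.1)
    · rw [Set.disjoint_left]
      rintro _ (⟨p, hp, rfl⟩ | ⟨p, hp, rfl⟩) ⟨q, hq, h⟩
      · exact hp (hout p hp q h.symm ▸ hq.1)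
      · rcases (hcyc q p).1 h with rfl | h
        · exact hp.2 hq.2
        · exact hp.2 ((minimalPeriod_eq_of_sameCycle h.2.2).trans hq.2)
  have hz₂ : (cycleAt θ '' B₂).ncard = (ε '' B₂).ncard := by
    refine ncard_image_eq_of_eq_iff fun p hp q hq => ?_
    rw [hcyc, hε p hp, sameCycle_iff hα, apply_apply_eq_of_minimalPeriod_ne hα hp.2]
    constructor
    · rintro (rfl | ⟨-, -, h⟩) <;> tauto
    · rintro (rfl | h)
      · exact Or.inl rfl
      · exact Or.inr ⟨hp.1, hq.1, by tauto⟩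
  have hz₃ : (cycleAt θ '' B₃).ncard = ((fun w : White α =>
      cycleAt (assocVertexPerm σ α) (Sum.inr w)) '' {w | (w : P) ∈ B}).ncard := by
    have hB₃ : B₃ = Subtype.val '' {w : White α | (w : P) ∈ B} := by
      ext p
      constructor
      · exact fun hp => ⟨⟨p, hp.2⟩, hp.1, rfl⟩
      · rintro ⟨w, hw, rfl⟩
        exact ⟨hw, w.2⟩
    rw [hB₃, Set.image_image]
    refine ncard_image_eq_of_eq_iff fun v hv w hw => ?_
    rw [hcyc, cycleAt_inr_eq_iff]
    constructor
    · rintro (h | h)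
      · rw [h]
      · exact h.2.2
    · exact fun h => Or.inr ⟨hv, hw, h⟩
  have hn : B.ncard + Bᶜ.ncard = Nat.card P := Set.ncard_add_ncard_compl B
  have hn₂ : B.ncard = B₂.ncard + B₃.ncard := by rw [hBB, Set.ncard_union_eq hd]
  rw [← hz₃]
  omega

/-- Both vertex and edge counts contain the number of white vertices met, which cancels and leaves
`z σ + z θ = |P| + 1`. Given transitivity, this already forces a single face, and then genus zero.
-/
theorem isTree_traceGraph_iff [Nonempty P] (hα : HasShortHyperedges α) {B : Set P}
    (hB : IsAdmissible α B) :
    IsTree (traceGraph σ α B) ↔ IsSpanningHypertree σ α (returnPerm hα B) := by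
  have h1 := ncard_vertexSet_traceGraph (σ := σ) (α := α) B
  have h2 := z_returnPerm_add_ncard_edgeSet (σ := σ) hα hB
  rw [isTree_iff, graphConnected_traceGraph_iff hα hB, IsSpanningHypertree, isHypermap_iff,
    genus_eq_zero_iff]
  constructor
  · rintro ⟨htop, hcard⟩
    have hz : z σ + z (returnPerm hα B) = Nat.card P + 1 := by omega
    have hface := z_inv_mul_eq_one σ _ htop hz
    exact ⟨isRefinement_returnPerm hα B, ⟨inferInstance, htop⟩, hface, by omega⟩
  · rintro ⟨-, ⟨-, htop⟩, hface, hg⟩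
    exact ⟨htop, by omega⟩

theorem numSpanningTrees_induce [Nonempty P] (hα : HasShortHyperedges α)
    {S : Set (Cycles (assocVertexPerm σ α))} (hS : S ⊆ whiteVertices σ α) :
    numSpanningTrees ((assocGraph σ α).induce ((assocGraph σ α).vertexSet \ S)) =
      Nat.card {B : Set P // (IsAdmissible α B ∧ IsSpanningHypertree σ α (returnPerm hα B)) ∧
        skippedVertices σ α B = S} := by
  symm
  let G := assocGraph σ α
  refine Nat.card_congr (Equiv.ofBijective (fun B => ⟨traceGraph σ α B.1, ?_,
    (isTree_traceGraph_iff hα B.2.1.1).2 B.2.1.2⟩) ⟨?_, ?_⟩)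
  · obtain ⟨B, hB, rfl⟩ := B
    exact ⟨Graph.restrict_le, rfl⟩
  · rintro ⟨B, hB⟩ ⟨B', hB'⟩ h
    have h1 : traceGraph σ α B = traceGraph σ α B' := congrArg Subtype.val h
    apply Subtype.ext
    ext p
    rw [← cycleAt_inl_mem_edgeSet_iff (σ := σ) hα hB.1.1, h1,
      cycleAt_inl_mem_edgeSet_iff hα hB'.1.1]
  · rintro ⟨T, hT, htree⟩
    have hTG : T ≤ G := hT.le.trans (Graph.induce_le Set.sdiff_subset)
    have hTV : T.vertexSet = G.vertexSet \ S := hT.vertexSet_eq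
    let B : Set P := {p | cycleAt (assocEdgePerm α) (Sum.inl p) ∈ T.edgeSet}
    have hTlink : ∀ p ∈ B, T.IsLink (cycleAt (assocEdgePerm α) (Sum.inl p))
        (cycleAt (assocVertexPerm σ α) (Sum.inl p))
        (cycleAt (assocVertexPerm σ α) (assocEdgePerm α (Sum.inl p))) := fun p hp =>
      (hTG.isLink_iff hp).2 (assocGraph_isLink hα
        (apply_ne_of_mem_edgeSet hα (hTG.edgeSet_mono hp)))
    have hB : IsAdmissible α B := by
      intro p hp
      have hne := apply_ne_of_mem_edgeSet hα (hTG.edgeSet_mono hp)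
      refine ⟨hne, fun h => ?_⟩
      have h3 : Function.minimalPeriod α p ≠ 3 := fun h3 =>
        ((minimalPeriod_eq_three_iff hα p).1 h3).2 h
      have h4 := cycleAt_assocEdgePerm_apply (α := α) (Sum.inl p)
      rw [assocEdgePerm_inl_of_ne h3] at h4
      change cycleAt (assocEdgePerm α) (Sum.inl (α p)) ∈ T.edgeSet
      rw [h4]
      exact hp
    have hskip : skippedVertices σ α B = S := by
      ext w
      constructor
      · rintro ⟨hw, hwB⟩
        by_contra hwS
        have hwT : w ∈ T.vertexSet := by rw [hTV]; exact ⟨Set.mem_univ _, hwS⟩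
        obtain ⟨p₀⟩ := (inferInstance : Nonempty P)
        have hbS : cycleAt (assocVertexPerm σ α) (Sum.inl p₀) ∉ S := fun h => by
          obtain ⟨v, hv⟩ := hS h
          exact cycleAt_inl_ne_inr σ α p₀ v hv.symm
        have hbT : cycleAt (assocVertexPerm σ α) (Sum.inl p₀) ∈ T.vertexSet := by
          rw [hTV]; exact ⟨Set.mem_univ _, hbS⟩
        -- A white vertex kept in the tree is joined to some black vertex, so its walk starts with
        -- an edge, whose black end lies in `B`.
        rcases (htree.1.2 w hwT _ hbT).cases_head with h | ⟨v, ⟨e, he⟩, -⟩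
        · obtain ⟨v, hv⟩ := hw
          exact cycleAt_inl_ne_inr σ α p₀ v (h.symm.trans hv.symm)
        · obtain ⟨x, -, -, hex, hwx, -⟩ := hTG.2 he
          rcases x with p | v
          · obtain ⟨v, hv⟩ := hw
            exact cycleAt_inl_ne_inr σ α p v (hwx.symm.trans hv.symm)
          · refine hwB v ⟨v.2, hwx⟩ ?_
            have h4 := cycleAt_assocEdgePerm_apply (α := α) (Sum.inr v)
            rw [assocEdgePerm_inr] at h4
            change cycleAt (assocEdgePerm α) (Sum.inl (v : P)) ∈ T.edgeSet
            rw [h4, ← hex]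
            exact he.edge_mem
      · intro hw
        refine ⟨hS hw, ?_⟩
        rintro p ⟨h3, rfl⟩ hp
        have h1 := (hTlink p hp).right_mem
        rw [assocEdgePerm_inl_of_eq h3, hTV] at h1
        exact h1.2 hw
    have hEq : traceGraph σ α B = T := by
      refine Graph.ext ?_ fun e x y => ?_
      · rw [vertexSet_traceGraph, hskip, hTV]
      · constructor
        · rintro ⟨⟨p, hp, rfl⟩, h, -⟩
          exact (hTG.isLink_iff hp).2 h
        · intro h
          obtain ⟨p, rfl⟩ := exists_cycleAt_inl e
          refine ⟨⟨p, h.edge_mem, rfl⟩, hTG.2 h, ?_, ?_⟩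
          · rw [hskip, ← hTV]; exact h.left_mem
          · rw [hskip, ← hTV]; exact h.right_mem
    refine ⟨⟨B, ⟨hB, ?_⟩, hskip⟩, Subtype.ext hEq⟩
    rw [← isTree_traceGraph_iff hα hB, hEq]
    exact htree

end TraceGraph

end Hypermap

/-! ### The double count over admissible sets. -/

theorem mainTheorem3 {P : Type*} [Finite P] (σ α : Equiv.Perm P)
    (hσα : Hypermap.IsHypermap σ α) (hα : Hypermap.HasShortHyperedges α) :
    (Hypermap.numSpanningHypertrees σ α : ℤ) =
      ∑ S ∈ (Set.toFinite (Hypermap.whiteVertices σ α)).toFinset.powerset,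
        (-2 : ℤ) ^ S.card *
          (Hypermap.numSpanningTrees
            ((Hypermap.assocGraph σ α).induce ((Hypermap.assocGraph σ α).vertexSet \ ↑S)) : ℤ) := by
  classical
  have hne : Nonempty P := ((Hypermap.isHypermap_iff σ α).1 hσα).1
  have := Fintype.ofFinite (Set P)
  have := Fintype.ofFinite (Equiv.Perm P)
  let 𝓑 : Finset (Set P) := Finset.univ.filter fun B => Hypermap.IsAdmissible α B ∧
    Hypermap.IsSpanningHypertree σ α (Hypermap.returnPerm hα B)
  let skip : Set P → Finset (Hypermap.Cycles (Hypermap.assocVertexPerm σ α)) := fun B =>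
    (Set.toFinite (Hypermap.skippedVertices σ α B)).toFinset
  -- Both sides are compared with the sum of `(-2)` to the number of skipped vertices over `𝓑`:
  -- grouped by skipped set it is the tree sum, grouped by return permutation it counts hypertrees.
  have hright : ∀ S ∈ (Set.toFinite (Hypermap.whiteVertices σ α)).toFinset.powerset,
      (-2 : ℤ) ^ S.card * (Hypermap.numSpanningTrees
        ((Hypermap.assocGraph σ α).induce ((Hypermap.assocGraph σ α).vertexSet \ ↑S)) : ℤ) =
      ∑ B ∈ 𝓑 with skip B = S, (-2 : ℤ) ^ (Hypermap.skippedVertices σ α B).ncard := by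
    intro S hS
    have hS' : (S : Set (Hypermap.Cycles (Hypermap.assocVertexPerm σ α))) ⊆
        Hypermap.whiteVertices σ α := fun w hw =>
      (Set.Finite.mem_toFinset _).1 (Finset.mem_powerset.1 hS hw)
    have hskip : ∀ B, skip B = S ↔ Hypermap.skippedVertices σ α B = S := by
      intro B
      rw [← Finset.coe_inj, Set.Finite.coe_toFinset]
    have hcard : ∀ B ∈ 𝓑.filter (skip · = S),
        (-2 : ℤ) ^ (Hypermap.skippedVertices σ α B).ncard = (-2 : ℤ) ^ S.card := by
      intro B hB
      rw [(hskip B).1 (Finset.mem_filter.1 hB).2, Set.ncard_coe_finset]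
    rw [Finset.sum_congr rfl hcard, Finset.sum_const, nsmul_eq_mul, mul_comm,
      Hypermap.numSpanningTrees_induce hα hS', Nat.card_eq_fintype_card, Fintype.card_subtype,
      Finset.filter_filter]
    simp only [hskip]
  have hmaps : ∀ B ∈ 𝓑, skip B ∈ (Set.toFinite (Hypermap.whiteVertices σ α)).toFinset.powerset := by
    intro B _
    rw [Finset.mem_powerset]
    intro w hw
    rw [Set.Finite.mem_toFinset] at hw ⊢
    exact hw.1
  rw [Finset.sum_congr rfl hright, Finset.sum_fiberwise_of_maps_to hmaps]
  let 𝓗 : Finset (Equiv.Perm P) := Finset.univ.filter (Hypermap.IsSpanningHypertree σ α)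
  have hmaps' : ∀ B ∈ 𝓑, Hypermap.returnPerm hα B ∈ 𝓗 := fun B hB =>
    Finset.mem_filter.2 ⟨Finset.mem_univ _, (Finset.mem_filter.1 hB).2.2⟩
  have hfiber : ∀ θ ∈ 𝓗, ∑ B ∈ 𝓑 with Hypermap.returnPerm hα B = θ,
      (-2 : ℤ) ^ (Hypermap.skippedVertices σ α B).ncard = 1 := by
    intro θ hθ
    have hθ' := (Finset.mem_filter.1 hθ).2
    rw [← Hypermap.sum_isTraceOf (σ := σ) hα θ, Finset.filter_filter]
    refine Finset.sum_congr (Finset.filter_congr fun B _ => ?_) fun _ _ => rfl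
    rw [Hypermap.isTraceOf_iff hα hθ'.1]
    constructor
    · exact fun h => ⟨h.1.1, h.2⟩
    · rintro ⟨h, rfl⟩
      exact ⟨⟨h, hθ'⟩, rfl⟩
  rw [← Finset.sum_fiberwise_of_maps_to hmaps', Finset.sum_congr rfl hfiber, Finset.sum_const,
    nsmul_eq_mul, mul_one, Hypermap.numSpanningHypertrees, Nat.card_eq_fintype_card,
    Fintype.card_subtype]
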